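/- Let $N\ge 4$ and consider the $N$-dimensional generalised Vaidya metric $$ds^2=-\Bigl(1-\frac{2m(v,r)}{r^{N-3}}\Bigr)dv^2+2\,dv\,dr+r^2d\Omega_{N-2}^2$$ on an open set $U$ of points $(v,r)$ with $r>0$ (times the angles). For $X>0$ write "$(v,r)\to(0,0)$ in the direction $X$" for $v\to0$, $r\to0^+$, $v/r\to X$. Let $c\in\mathbb R$ and assume that for every $X\in(0,c)$ all points with $r>0$ that are close enough to $(0,0)$ and have $v/r$ close enough to $X$ lie in $U$ (for instance $U=\{v>0,\,r>0\}$ and any $c$). Write $\dot m=\partial m/\partial v$, $m'=\partial m/\partial r$, $m''=\partial^2m/\partial r^2$. Assume that on $U$ the mass function $m$ is continuously differentiable, that $m'$ is differentiable in $r$, and that, with $$\mu=\frac{(N-2)\dot m}{r^{N-2}},\qquad \rho=\frac{(N-2)m'}{r^{N-2}},\qquad \varrho=-\frac{m''}{r^{N-3}},$$ the weak, strong and dominant energy conditions $\mu\ge0$, $\rho\ge0$, $\varrho\ge0$, $\rho\ge\varrho$ hold. Assume that the collapse starts from a regular epoch, in the sense that $m(v,r)\to0$ as $(v,r)\to(0,0)$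 in every direction $X\in(0,c)$. The point $v=0$, $r=0$ is called the central singularity. Suppose: 1. The limits of the partial derivatives of $m$ at the central singularity exist: for every $X\in(0,c)$ the limits $$p(X)=\lim\frac{m'(v,r)}{r^{N-4}},\qquad q(X)=\lim\frac{\dot m(v,r)}{r^{N-4}}$$ as $(v,r)\to(0,0)$ in the direction $X$ exist (for $N=4$ these are the limits of $m'$ and $\dot m$ themselves). 2. $X_0\in(0,c)$ is a root of $$X_0=\lim\frac{2(N-3)r^{N-4}}{(N-3)r^{N-4}-2m'-2\dot m X_0}=\frac{2(N-3)}{(N-3)-2p(X_0)-2q(X_0)X_0},$$ and it is nondegenerate in the sense that it is an isolated root at which the difference of the two sides changes sign (as it does at every root of multiplicity one). 3. $X_0$ is smaller than every root $X_{AH}\in(0,c)$ of the equation for the slope of the apparent horizon $2m=r^{N-3}$ at the central singularity, $$X_{AH}=\frac{(N-3)-2p(X_{AH})}{2q(X_{AH})}.$$ Then the central singularity is locally naked: some future-directed outgoing radial null geodesic terminates in the past, at a finite value of its affine parameter, at the central singularity. More precisely, there are $\varepsilon>0$ and a $C^1$ function $V:[0,\varepsilon)\to\mathbb R$ with $V(0)=0$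 and $V'(0)=X_0$ such that, for $0<r<\varepsilon$, $$2m(V(r),r)<r^{N-3},\qquad V'(r)=\frac{2r^{N-3}}{r^{N-3}-2m(V(r),r)},$$ and the curve $v=V(r)$, $0<r<\varepsilon$, is (at any fixed angles) the trajectory of an affinely parametrised radial null geodesic in $U$ that comes out of the central singularity and along which $v$ and $r$ increase to the future. -/

import Mathlib

open Filter Topology Set

noncomputable section

namespace Vaidya

/-- Partial derivative of the mass function in the advanced time `v`. -/
def mDot (m : ℝ → ℝ → ℝ) (v r : ℝ) : ℝ := deriv (fun s => m s r) v

/-- Partial derivative of the mass function in the radius `r`. -/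
def mPrime (m : ℝ → ℝ → ℝ) (v r : ℝ) : ℝ := deriv (fun s => m v s) r

/-- Second partial derivative of the mass function in the radius `r`. -/
def mPrimePrime (m : ℝ → ℝ → ℝ) (v r : ℝ) : ℝ := deriv (fun s => mPrime m v s) r

/-! ### The metric and its geodesics -/

/-- The coordinate labels of the `N`-dimensional spacetime: `inl 0` is `v`, `inl 1` is `r`, and
`inr i` are the `N - 2` angles. -/
abbrev Index (N : ℕ) : Type := Fin 2 ⊕ Fin (N - 2)

/-- The generalised Vaidya metric
`-(1 - 2 m(v,r) / r^(N-3)) dv² + 2 dv dr + r² ∑ᵢ (∏_{j<i} sin² θʲ) (dθⁱ)²`. -/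
def metric (N : ℕ) (m : ℝ → ℝ → ℝ) (x : Index N → ℝ) : Matrix (Index N) (Index N) ℝ :=
  Matrix.fromBlocks
    !![-(1 - 2 * m (x (Sum.inl 0)) (x (Sum.inl 1)) / x (Sum.inl 1) ^ (N - 3)), 1; 1, 0]
    0 0
    (Matrix.diagonal fun i =>
      x (Sum.inl 1) ^ 2 * ∏ j ∈ Finset.Iio i, Real.sin (x (Sum.inr j)) ^ 2)

/-- The curve `γ` is an affinely parametrised geodesic of the metric `g` on the parameter set `I`:
it is twice differentiable and satisfies the Lagrange equations of
`L = ½ g_{bc} (dx^b/dk) (dx^c/dk)`, that is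
`d/dk (g_{ab} dx^b/dk) = ½ (∂g_{bc}/∂x^a) (dx^b/dk) (dx^c/dk)` for every `a`. -/
def IsGeodesicOn {ι : Type} [Fintype ι] [DecidableEq ι] (g : (ι → ℝ) → Matrix ι ι ℝ)
    (γ : ℝ → ι → ℝ) (I : Set ℝ) : Prop :=
  ∀ k ∈ I, ∀ a : ι,
    DifferentiableAt ℝ (fun s => γ s a) k ∧
    DifferentiableAt ℝ (deriv fun s => γ s a) k ∧
    HasDerivAt (fun s => ∑ b, g (γ s) a b * deriv (fun t => γ t b) s)
      (1 / 2 * ∑ b, ∑ c, deriv (fun y => g (Function.update (γ k) a y) b c) (γ k a)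
        * deriv (fun t => γ t b) k * deriv (fun t => γ t c) k) k

/-- The curve `γ` is null for the metric `g` on the parameter set `I`. -/
def IsNullOn {ι : Type} [Fintype ι] (g : (ι → ℝ) → Matrix ι ι ℝ)
    (γ : ℝ → ι → ℝ) (I : Set ℝ) : Prop :=
  ∀ k ∈ I, ∑ a, ∑ b, g (γ k) a b * deriv (fun t => γ t a) k * deriv (fun t => γ t b) k = 0

/-- The radial curve `k ↦ (v k, r k)` at the fixed angles `θ`. -/
def radialCurve {N : ℕ} (v r : ℝ → ℝ) (θ : Fin (N - 2) → ℝ) (k : ℝ) : Index N → ℝ :=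
  Sum.elim ![v k, r k] θ

/-- `k ↦ (v k, r k)`, `0 < k < b`, is (at all fixed angles) a future-directed outgoing radial null
geodesic in the spacetime region `U`: the advanced time `v` and the radius `r` both increase
towards the future. The parameter `k` is affine. -/
structure IsOutgoingRadialNullGeodesic (N : ℕ) (m : ℝ → ℝ → ℝ) (U : Set (ℝ × ℝ))
    (b : ℝ) (v r : ℝ → ℝ) : Prop where
  mem : ∀ k ∈ Ioo 0 b, (v k, r k) ∈ U
  geodesic : ∀ θ : Fin (N - 2) → ℝ, IsGeodesicOn (metric N m) (radialCurve v r θ) (Ioo 0 b)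
  null : ∀ θ : Fin (N - 2) → ℝ, IsNullOn (metric N m) (radialCurve v r θ) (Ioo 0 b)
  future : ∀ k ∈ Ioo 0 b, 0 < deriv v k
  outgoing : ∀ k ∈ Ioo 0 b, 0 < deriv r k

/-- The geodesic terminates in the past, at the finite affine parameter `k = 0`, at the central
singularity `v = 0`, `r = 0`. -/
def EmanatesFromSingularity (v r : ℝ → ℝ) : Prop :=
  Tendsto (fun k => (v k, r k)) (𝓝[>] 0) (𝓝 (0, 0))

/-- The central singularity `v = 0`, `r = 0` is locally naked: some future-directed outgoing radial
null geodesic comes out of it. -/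
def LocallyNaked (N : ℕ) (m : ℝ → ℝ → ℝ) (U : Set (ℝ × ℝ)) : Prop :=
  ∃ b > 0, ∃ v r : ℝ → ℝ,
    IsOutgoingRadialNullGeodesic N m U b v r ∧ EmanatesFromSingularity v r

/-! ### The matter content -/

/-- Energy density `μ` of the matter that moves along the null hypersurfaces `v = const`. -/
def nullDensity (N : ℕ) (m : ℝ → ℝ → ℝ) (v r : ℝ) : ℝ :=
  ((N : ℝ) - 2) * mDot m v r / r ^ (N - 2)

/-- Energy density `ρ` of the matter that moves along timelike trajectories. -/
def density (N : ℕ) (m : ℝ → ℝ → ℝ) (v r : ℝ) : ℝ :=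
  ((N : ℝ) - 2) * mPrime m v r / r ^ (N - 2)

/-- Pressure `ϱ` of the matter that moves along timelike trajectories. -/
def pressure (N : ℕ) (m : ℝ → ℝ → ℝ) (v r : ℝ) : ℝ :=
  - mPrimePrime m v r / r ^ (N - 3)

/-- The weak and strong energy conditions at `(v, r)`. The pure Type I case `μ = 0` is allowed. -/
def WeakStrongEnergy (N : ℕ) (m : ℝ → ℝ → ℝ) (v r : ℝ) : Prop :=
  0 ≤ nullDensity N m v r ∧ 0 ≤ density N m v r ∧ 0 ≤ pressure N m v r

/-- The dominant energy condition at `(v, r)`. The pure Type I case `μ = 0` is allowed. -/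
def DominantEnergy (N : ℕ) (m : ℝ → ℝ → ℝ) (v r : ℝ) : Prop :=
  0 ≤ nullDensity N m v r ∧ pressure N m v r ≤ density N m v r ∧ 0 ≤ pressure N m v r

/-! ### Limits at the central singularity -/

/-- The approach `(v, r) → (0, 0)` to the central singularity through `r > 0` with limiting
direction `v / r → X`. -/
def towards (X : ℝ) : Filter (ℝ × ℝ) :=
  𝓝 (0, 0) ⊓ 𝓟 {p | 0 < p.2} ⊓ comap (fun p : ℝ × ℝ => p.1 / p.2) (𝓝 X)

/-- `(U, m)` is an `N`-dimensional generalised Vaidya spacetime that collapses to a central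
singularity at `v = 0`, `r = 0`: `U` is an open set of points `(v, r)` with `r > 0` which contains
the vicinity of the singularity in all directions `v / r = X`, `0 < X < c`. The mass function is
differentiable to the order that the metric connection and the matter variables require, it
satisfies the energy conditions, and no mass is present at the centre when the singularity starts
to form. -/
structure IsCollapsing (N : ℕ) (m : ℝ → ℝ → ℝ) (U : Set (ℝ × ℝ)) (c : ℝ) : Prop where
  isOpen : IsOpen U
  radius_pos : ∀ p ∈ U, 0 < p.2
  vicinity : ∀ X ∈ Ioo 0 c, ∀ᶠ p in towards X, p ∈ U
  contDiff : ContDiffOn ℝ 1 (fun p : ℝ × ℝ => m p.1 p.2) U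
  differentiable_mPrime : ∀ p ∈ U, DifferentiableAt ℝ (fun s => mPrime m p.1 s) p.2
  weakStrong : ∀ p ∈ U, WeakStrongEnergy N m p.1 p.2
  dominant : ∀ p ∈ U, DominantEnergy N m p.1 p.2
  mass_zero : ∀ X ∈ Ioo 0 c, Tendsto (fun p : ℝ × ℝ => m p.1 p.2) (towards X) (𝓝 0)

/-- `p X` and `q X` are the limits at the central singularity, in the direction `v / r → X`, of
the partial derivatives of the mass function in `r` and in `v`, measured in units of `r ^ (N-4)`
(for `N = 4` this factor is `1`). -/
def HasDerivativeLimits (N : ℕ) (m : ℝ → ℝ → ℝ) (c : ℝ) (p q : ℝ → ℝ) : Prop :=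
  ∀ X ∈ Ioo 0 c,
    Tendsto (fun z : ℝ × ℝ => mPrime m z.1 z.2 / z.2 ^ (N - 4)) (towards X) (𝓝 (p X)) ∧
    Tendsto (fun z : ℝ × ℝ => mDot m z.1 z.2 / z.2 ^ (N - 4)) (towards X) (𝓝 (q X))

/-- The limit of `2 (N-3) r^(N-4) / ((N-3) r^(N-4) - 2 m' - 2 ṁ X)` at the central singularity in
the direction `X`. -/
def slopeLimit (N : ℕ) (p q : ℝ → ℝ) (X : ℝ) : ℝ :=
  2 * ((N : ℝ) - 3) / (((N : ℝ) - 3) - 2 * p X - 2 * q X * X)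

/-- The limit of `((N-3) r^(N-4) - 2 m') / (2 ṁ)` at the central singularity in the direction
`X`. -/
def horizonSlopeLimit (N : ℕ) (p q : ℝ → ℝ) (X : ℝ) : ℝ :=
  (((N : ℝ) - 3) - 2 * p X) / (2 * q X)

/-- The positive number `X` is a root of the algebraic equation `X₀ = slopeLimit X₀` for the
tangents of null geodesics at the singularity (positivity forces the denominator to be
nonzero). -/
def IsTangentRoot (N : ℕ) (p q : ℝ → ℝ) (X : ℝ) : Prop :=
  0 < X ∧ X = slopeLimit N p q X

/-- The positive number `X` is a root of the equation `X_AH = horizonSlopeLimit X_AH` for the slope of the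
apparent horizon `2 m = r^(N-3)` at the singularity (positivity forces the denominator to be
nonzero). -/
def IsHorizonRoot (N : ℕ) (p q : ℝ → ℝ) (X : ℝ) : Prop :=
  0 < X ∧ X = horizonSlopeLimit N p q X

/-- The root `X₀` of the tangent equation is isolated and nondegenerate, in the sense that
`slopeLimit X - X` changes sign at it. Every root of multiplicity one is of this kind. -/
def ChangesSignAt (N : ℕ) (p q : ℝ → ℝ) (X₀ : ℝ) : Prop :=
  (∀ᶠ X in 𝓝[≠] X₀, 0 < (slopeLimit N p q X - X) * (X - X₀)) ∨
  (∀ᶠ X in 𝓝[≠] X₀, (slopeLimit N p q X - X) * (X - X₀) < 0)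

end Vaidya

end

/-!
In the coordinates `x = v / r` and `r`, outgoing radial null curves solve
`r dx/dr = 2 / A - x` with the lapse `A = 1 - 2 m / r ^ (N - 3)`. Integrating
`dm/dr = m' + x ṁ` along the rays `v = x r`, from zero mass at the singularity, gives
`m / r ^ (N - 3) → (p + x q) / (N - 3)`, uniformly for `x` near a given direction
(`IsCollapsing.tendsto_mass_div`). So `2 / A` tends to `slopeLimit`, and the equation is
asymptotically the autonomous one `dx / d log r = slopeLimit x - x`, whose equilibrium is `X₀`.
In particular the lapse has a positive limit in the direction `X₀`, so the curve starts outside the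
apparent horizon.

The sign change of `slopeLimit x - x` at `X₀` makes the field `2 / A` point, at small radii, either
inwards or outwards along both edges of a wedge `(X₀ - δ) r ≤ v ≤ (X₀ + δ) r`. A solution that stays
in the wedge comes from monotone iteration of an integral equation
(`exists_fixedPoint_of_monotone`). If the field points inwards, one integrates from `r = 0`; the
operator is monotone because `ṁ ≥ 0` makes the lapse decrease in `v`. If it points outwards, one
integrates from `r = R` towards the singularity, with an integrating factor `r ^ (-L)` that
dominates the derivative of `2 / A` in `v`, which is `O(1 / r)` because `ṁ / r ^ (N - 4)` is bounded.
Every solution in the wedge leaves the singularity in the direction `X₀`, because `(V / r - X₀) ^ 2`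
would otherwise run off monotonically in `-log r` (`tendsto_div_of_sign`).

The Lagrange equations for a radial null curve reduce to `du/dr = -(A_r / A) u` for the affine
velocity `u = dv/dk`, where `A_r` is the radial derivative of the lapse, together with
`dk/dr = 2 / (A u)`. Since `r A_r → 2 X₀ q(X₀) ≥ 0`, the function
`1 / u` is at most of order `r ^ (-1/2)`, which is integrable at `0`: the singularity lies at a
finite value of the affine parameter (`exists_affine_parametrisation`).
-/

noncomputable section

namespace Vaidya

/-! ### Solutions in a wedge by monotone iteration -/

/-- The wedge `a r ≤ v ≤ b r`, `0 < r ≤ R`, in the `(v, r)` half-plane, with its tip removed. -/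
def wedge (a b R : ℝ) : Set (ℝ × ℝ) := {z | z.2 ∈ Ioc 0 R ∧ z.1 ∈ Icc (a * z.2) (b * z.2)}

theorem continuousOn_primitive_Ioc {R e : ℝ} {g : ℝ → ℝ}
    (hg : ∀ r ∈ Ioc 0 R, IntervalIntegrable g MeasureTheory.volume e r) :
    ContinuousOn (fun r => ∫ s in e..r, g s) (Ioc 0 R) := by
  intro r hr
  have hR : R ∈ Ioc 0 R := ⟨hr.1.trans_le hr.2, le_rfl⟩
  have hr2 : r / 2 ∈ Ioc 0 R := ⟨by linarith [hr.1], by linarith [hr.1, hr.2]⟩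
  have hsub : IntervalIntegrable g MeasureTheory.volume (r / 2) R :=
    (hg _ hr2).symm.trans (hg R hR)
  have h1 := intervalIntegral.continuousOn_primitive_interval' hsub right_mem_uIcc
  rw [uIcc_of_le hr2.2] at h1
  have h2 : ContinuousOn (fun x => (∫ s in e..R, g s) + ∫ s in R..x, g s) (Icc (r / 2) R) :=
    continuousOn_const.add h1
  have h3 : ContinuousWithinAt (fun r => ∫ s in e..r, g s) (Icc (r / 2) R) r := by
    refine (h2 r ⟨by linarith [hr.1], hr.2⟩).congr (fun y hy => ?_) ?_
    · have hy' : y ∈ Ioc 0 R := ⟨hr2.1.trans_le hy.1, hy.2⟩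
      exact (intervalIntegral.integral_add_adjacent_intervals (hg R hR)
        ((hg R hR).symm.trans (hg y hy'))).symm
    · exact (intervalIntegral.integral_add_adjacent_intervals (hg R hR)
        ((hg R hR).symm.trans (hg r hr))).symm
  refine h3.mono_of_mem_nhdsWithin ?_
  have : Ioi (r / 2) ∩ Ioc 0 R ∈ 𝓝[Ioc 0 R] r :=
    inter_mem (mem_nhdsWithin_of_mem_nhds (Ioi_mem_nhds (by linarith [hr.1])))
      self_mem_nhdsWithin
  exact mem_of_superset this fun x hx => ⟨le_of_lt hx.1, hx.2.2⟩

/-- Monotone iteration: a Volterra operator `V ↦ A r (C + ∫_e^r H (V s) s ds)` that is monotone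
and maps the functions with graph in a wedge to themselves has a continuous fixed point there. The
iterates of the lower edge increase, and the integrals converge by domination. The base point `e`
may be `0` or `R`. -/
theorem exists_fixedPoint_of_monotone {a b R e C : ℝ} {A B : ℝ → ℝ} {H : ℝ → ℝ → ℝ}
    (hab : a ≤ b)
    (hA : ContinuousOn A (Ioc 0 R))
    (hH : ContinuousOn (fun z : ℝ × ℝ => H z.1 z.2) (wedge a b R))
    (he : ∀ r ∈ Ioc 0 R, uIoc e r ⊆ Ioc 0 R)
    (hB : ∀ r ∈ Ioc 0 R, IntervalIntegrable B MeasureTheory.volume e r)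
    (hHB : ∀ z ∈ wedge a b R, |H z.1 z.2| ≤ B z.2)
    (hmaps : ∀ V : ℝ → ℝ, ContinuousOn V (Ioc 0 R) →
      (∀ r ∈ Ioc 0 R, V r ∈ Icc (a * r) (b * r)) →
      (∀ r ∈ Ioc 0 R, IntervalIntegrable (fun s => H (V s) s) MeasureTheory.volume e r) →
      ∀ r ∈ Ioc 0 R, A r * (C + ∫ s in e..r, H (V s) s) ∈ Icc (a * r) (b * r))
    (hmono : ∀ V W : ℝ → ℝ,
      (∀ r ∈ Ioc 0 R, V r ∈ Icc (a * r) (b * r)) → (∀ r ∈ Ioc 0 R, W r ∈ Icc (a * r) (b * r)) →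
      (∀ r ∈ Ioc 0 R, IntervalIntegrable (fun s => H (V s) s) MeasureTheory.volume e r) →
      (∀ r ∈ Ioc 0 R, IntervalIntegrable (fun s => H (W s) s) MeasureTheory.volume e r) →
      (∀ r ∈ Ioc 0 R, V r ≤ W r) →
      ∀ r ∈ Ioc 0 R, A r * (C + ∫ s in e..r, H (V s) s) ≤ A r * (C + ∫ s in e..r, H (W s) s)) :
    ∃ V : ℝ → ℝ, ContinuousOn V (Ioc 0 R) ∧ (∀ r ∈ Ioc 0 R, V r ∈ Icc (a * r) (b * r)) ∧
      (∀ r ∈ Ioc 0 R, IntervalIntegrable (fun s => H (V s) s) MeasureTheory.volume e r) ∧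
      ∀ r ∈ Ioc 0 R, V r = A r * (C + ∫ s in e..r, H (V s) s) := by
  set T : (ℝ → ℝ) → ℝ → ℝ := fun V r => A r * (C + ∫ s in e..r, H (V s) s) with hT
  have hcomp : ∀ V : ℝ → ℝ, ContinuousOn V (Ioc 0 R) →
      (∀ r ∈ Ioc 0 R, V r ∈ Icc (a * r) (b * r)) →
      ContinuousOn (fun s => H (V s) s) (Ioc 0 R) := fun V hV hVw =>
    hH.comp (hV.prodMk continuousOn_id) fun r hr => ⟨hr, hVw r hr⟩
  have hmeas : ∀ V : ℝ → ℝ, ContinuousOn V (Ioc 0 R) →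
      (∀ r ∈ Ioc 0 R, V r ∈ Icc (a * r) (b * r)) → ∀ r ∈ Ioc 0 R,
      MeasureTheory.AEStronglyMeasurable (fun s => H (V s) s)
        (MeasureTheory.volume.restrict (uIoc e r)) := fun V hV hVw r hr =>
    ((hcomp V hV hVw).mono (he r hr)).aestronglyMeasurable measurableSet_uIoc
  have hint : ∀ V : ℝ → ℝ, (∀ r ∈ Ioc 0 R, V r ∈ Icc (a * r) (b * r)) → ∀ r ∈ Ioc 0 R,
      MeasureTheory.AEStronglyMeasurable (fun s => H (V s) s)
        (MeasureTheory.volume.restrict (uIoc e r)) →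
      IntervalIntegrable (fun s => H (V s) s) MeasureTheory.volume e r := fun V hVw r hr hm =>
    (hB r hr).mono_fun' hm <| (MeasureTheory.ae_restrict_iff' measurableSet_uIoc).2 <|
      Eventually.of_forall fun s hs => hHB (V s, s) ⟨he r hr hs, hVw s (he r hr hs)⟩
  set S : ℕ → ℝ → ℝ := fun k => T^[k] (fun r => a * r) with hS
  have hSsucc : ∀ k, S (k + 1) = T (S k) := fun k => Function.iterate_succ_apply' T k _
  have hSgood : ∀ k, ContinuousOn (S k) (Ioc 0 R) ∧
      ∀ r ∈ Ioc 0 R, S k r ∈ Icc (a * r) (b * r) := by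
    intro k
    induction k with
    | zero =>
      refine ⟨by simp only [hS, Function.iterate_zero, id]; fun_prop, fun r hr => ?_⟩
      simp only [hS, Function.iterate_zero, id]
      exact ⟨le_rfl, mul_le_mul_of_nonneg_right hab hr.1.le⟩
    | succ k ih =>
      have hi : ∀ r ∈ Ioc 0 R, IntervalIntegrable (fun s => H (S k s) s)
          MeasureTheory.volume e r := fun r hr => hint _ ih.2 r hr (hmeas _ ih.1 ih.2 r hr)
      rw [hSsucc]
      exact ⟨hA.mul (continuousOn_const.add (continuousOn_primitive_Ioc hi)),
        hmaps _ ih.1 ih.2 hi⟩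
  have hSint : ∀ k, ∀ r ∈ Ioc 0 R, IntervalIntegrable (fun s => H (S k s) s)
      MeasureTheory.volume e r := fun k r hr =>
    hint _ (hSgood k).2 r hr (hmeas _ (hSgood k).1 (hSgood k).2 r hr)
  have hSstep : ∀ k, ∀ r ∈ Ioc 0 R, S k r ≤ S (k + 1) r := by
    intro k
    induction k with
    | zero => exact fun r hr => ((hSgood 1).2 r hr).1
    | succ k ih =>
      rw [hSsucc (k + 1), hSsucc k]
      have := hmono (S k) (S (k + 1)) (hSgood k).2 (hSgood (k + 1)).2 (hSint k) (hSint (k + 1)) ih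
      rwa [hSsucc k] at this
  have hlim : ∀ r ∈ Ioc 0 R, Tendsto (fun k => S k r) atTop (𝓝 (⨆ k, S k r)) := fun r hr =>
    tendsto_atTop_ciSup (monotone_nat_of_le_succ fun k => hSstep k r hr)
      ⟨b * r, by rintro _ ⟨k, rfl⟩; exact ((hSgood k).2 r hr).2⟩
  have hVw : ∀ r ∈ Ioc 0 R, (⨆ k, S k r) ∈ Icc (a * r) (b * r) := fun r hr =>
    isClosed_Icc.mem_of_tendsto (hlim r hr) (Eventually.of_forall fun k => (hSgood k).2 r hr)
  have hHlim : ∀ s ∈ Ioc 0 R,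
      Tendsto (fun k => H (S k s) s) atTop (𝓝 (H (⨆ k, S k s) s)) := by
    intro s hs
    refine (hH (⨆ k, S k s, s) ⟨hs, hVw s hs⟩).tendsto.comp
      (tendsto_nhdsWithin_iff.2 ⟨(hlim s hs).prodMk_nhds tendsto_const_nhds,
        Eventually.of_forall fun k => ⟨hs, (hSgood k).2 s hs⟩⟩)
  have hVmeas : ∀ r ∈ Ioc 0 R, MeasureTheory.AEStronglyMeasurable (fun s => H (⨆ k, S k s) s)
        (MeasureTheory.volume.restrict (uIoc e r)) := fun r hr =>
    aestronglyMeasurable_of_tendsto_ae atTop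
      (fun k => hmeas _ (hSgood k).1 (hSgood k).2 r hr)
      ((MeasureTheory.ae_restrict_iff' measurableSet_uIoc).2 <|
        Eventually.of_forall fun s hs => hHlim s (he r hr hs))
  have hVint := fun r hr => hint _ hVw r hr (hVmeas r hr)
  have hVeq : ∀ r ∈ Ioc 0 R, (⨆ k, S k r) = T (fun s => ⨆ k, S k s) r := by
    intro r hr
    have h1 : Tendsto (fun k => ∫ s in e..r, H (S k s) s) atTop
        (𝓝 (∫ s in e..r, H (⨆ k, S k s) s)) :=
      intervalIntegral.tendsto_integral_filter_of_dominated_convergence B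
        (Eventually.of_forall fun k => hmeas _ (hSgood k).1 (hSgood k).2 r hr)
        (Eventually.of_forall fun k => Eventually.of_forall fun s hs =>
          hHB (S k s, s) ⟨he r hr hs, (hSgood k).2 s (he r hr hs)⟩)
        (hB r hr) (Eventually.of_forall fun s hs => hHlim s (he r hr hs))
    have h2 : Tendsto (fun k => S (k + 1) r) atTop (𝓝 (T (fun s => ⨆ k, S k s) r)) := by
      simp only [hSsucc]
      exact (h1.const_add C).const_mul (A r)
    exact tendsto_nhds_unique ((tendsto_add_atTop_iff_nat 1).2 (hlim r hr)) h2
  refine ⟨fun r => ⨆ k, S k r, ?_, hVw, hVint, hVeq⟩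
  exact (hA.mul (continuousOn_const.add (continuousOn_primitive_Ioc hVint))).congr hVeq

/-- If the slope at the two edges of the wedge points into it as `r` grows, then the Volterra
operator `V ↦ ∫_0^r Φ (V s) s ds` preserves the wedge, and its fixed point solves the equation. -/
theorem exists_solution_of_edges_inward {a b R B : ℝ} {Φ : ℝ → ℝ → ℝ} (hab : a ≤ b)
    (hΦ : ContinuousOn (fun z : ℝ × ℝ => Φ z.1 z.2) (wedge a b R))
    (hB : ∀ z ∈ wedge a b R, |Φ z.1 z.2| ≤ B)
    (hmono : ∀ r ∈ Ioc 0 R, MonotoneOn (fun v => Φ v r) (Icc (a * r) (b * r)))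
    (hlo : ∀ r ∈ Ioc 0 R, a ≤ Φ (a * r) r) (hhi : ∀ r ∈ Ioc 0 R, Φ (b * r) r ≤ b) :
    ∃ V : ℝ → ℝ, (∀ r ∈ Ioo 0 R, V r ∈ Icc (a * r) (b * r)) ∧
      ∀ r ∈ Ioo 0 R, HasDerivAt V (Φ (V r) r) r := by
  have he : ∀ r ∈ Ioc 0 R, uIoc 0 r ⊆ Ioc 0 R := fun r hr => by
    rw [uIoc_of_le hr.1.le]; exact Ioc_subset_Ioc_right hr.2
  have hle : ∀ r ∈ Ioc 0 R, a * r ≤ b * r := fun r hr => mul_le_mul_of_nonneg_right hab hr.1.le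
  obtain ⟨V, hVc, hVw, hVi, hV⟩ := exists_fixedPoint_of_monotone (C := 0) (e := 0)
    (A := fun _ => 1) (B := fun _ => B) (H := Φ) hab continuousOn_const hΦ he
    (fun r _ => intervalIntegrable_const) hB
    (by
      intro V _ hVw hVi r hr
      have hlow : ∫ s in (0:ℝ)..r, a ≤ ∫ s in (0:ℝ)..r, Φ (V s) s := by
        refine intervalIntegral.integral_mono_on_of_le_Ioo hr.1.le (by simp) (hVi r hr) ?_
        intro s hs
        have hs' : s ∈ Ioc 0 R := ⟨hs.1, hs.2.le.trans hr.2⟩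
        exact (hlo s hs').trans
          (hmono s hs' ⟨le_rfl, hle s hs'⟩ (hVw s hs') (hVw s hs').1)
      have hup : ∫ s in (0:ℝ)..r, Φ (V s) s ≤ ∫ s in (0:ℝ)..r, b := by
        refine intervalIntegral.integral_mono_on_of_le_Ioo hr.1.le (hVi r hr) (by simp) ?_
        intro s hs
        have hs' : s ∈ Ioc 0 R := ⟨hs.1, hs.2.le.trans hr.2⟩
        exact (hmono s hs' (hVw s hs') ⟨hle s hs', le_rfl⟩ (hVw s hs').2).trans (hhi s hs')
      simp only [intervalIntegral.integral_const, smul_eq_mul, sub_zero] at hlow hup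
      rw [mul_comm r] at hlow hup
      simpa using ⟨hlow, hup⟩)
    (by
      intro V W hVw hWw hVi hWi hVW r hr
      simp only [one_mul, zero_add]
      refine intervalIntegral.integral_mono_on_of_le_Ioo hr.1.le (hVi r hr) (hWi r hr) ?_
      intro s hs
      have hs' : s ∈ Ioc 0 R := ⟨hs.1, hs.2.le.trans hr.2⟩
      exact hmono s hs' (hVw s hs') (hWw s hs') (hVW s hs'))
  refine ⟨V, fun r hr => hVw r ⟨hr.1, hr.2.le⟩, fun r hr => ?_⟩
  have hr' : r ∈ Ioc 0 R := ⟨hr.1, hr.2.le⟩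
  have hc : ContinuousOn (fun s => Φ (V s) s) (Ioo 0 R) :=
    hΦ.comp ((hVc.mono Ioo_subset_Ioc_self).prodMk continuousOn_id)
      fun r hr => ⟨⟨hr.1, hr.2.le⟩, hVw r ⟨hr.1, hr.2.le⟩⟩
  have hd := intervalIntegral.integral_hasDerivAt_right (hVi r hr')
    (hc.stronglyMeasurableAtFilter isOpen_Ioo r hr) (hc.continuousAt (Ioo_mem_nhds hr.1 hr.2))
  refine hd.congr_of_eventuallyEq ?_
  filter_upwards [Ioo_mem_nhds hr.1 hr.2] with s hs
  simpa using hV s ⟨hs.1, hs.2.le⟩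

/-- If the slope at the two edges of the wedge points out of it as `r` grows, the equation is
solved from `r = R` inwards. The integrating factor `r ^ (-L)` turns the equation into
`(V / r ^ L)' = (Φ - L V / r) / r ^ L`, whose right side is decreasing in `V` once `L / r` exceeds
the Lipschitz constant of `Φ`; integrated from `R` down to `r`, it gives a monotone operator. -/
theorem exists_solution_of_edges_outward {a b R B L : ℝ} {Φ : ℝ → ℝ → ℝ} (ha : 0 ≤ a)
    (hab : a ≤ b) (hR : 0 < R)
    (hΦ : ContinuousOn (fun z : ℝ × ℝ => Φ z.1 z.2) (wedge a b R))
    (hB : ∀ z ∈ wedge a b R, |Φ z.1 z.2| ≤ B) (hL : 1 < L)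
    (hanti : ∀ r ∈ Ioc 0 R, MonotoneOn (fun v => L * v / r - Φ v r) (Icc (a * r) (b * r)))
    (hlo : ∀ r ∈ Ioc 0 R, Φ (a * r) r ≤ a) (hhi : ∀ r ∈ Ioc 0 R, b ≤ Φ (b * r) r) :
    ∃ V : ℝ → ℝ, (∀ r ∈ Ioo 0 R, V r ∈ Icc (a * r) (b * r)) ∧
      ∀ r ∈ Ioo 0 R, HasDerivAt V (Φ (V r) r) r := by
  have he : ∀ r ∈ Ioc 0 R, uIoc R r ⊆ Ioc 0 R := fun r hr => by
    rw [uIoc_of_ge hr.2]; exact Ioc_subset_Ioc_left hr.1.le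
  have hle : ∀ r ∈ Ioc 0 R, a * r ≤ b * r := fun r hr => mul_le_mul_of_nonneg_right hab hr.1.le
  have hb : 0 ≤ b := ha.trans hab
  have hpc : ∀ e : ℝ, ContinuousOn (fun s : ℝ => s ^ e) (Ioc 0 R) := fun e =>
    continuousOn_id.rpow_const fun s hs => Or.inl hs.1.ne'
  have hpi : ∀ (e : ℝ) (M : ℝ), ∀ r ∈ Ioc 0 R,
      IntervalIntegrable (fun s : ℝ => s ^ e * M) MeasureTheory.volume R r := fun e M r hr => by
    refine ContinuousOn.intervalIntegrable ?_
    rw [uIcc_of_ge hr.2]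
    exact ((hpc e).mul continuousOn_const).mono fun s hs => ⟨hr.1.trans_le hs.1, hs.2⟩
  -- The constant-slope case: both edges are fixed by the operator with their own end value.
  have hedge : ∀ x : ℝ, ∀ r ∈ Ioc 0 R,
      r ^ L * (x * R ^ (1 - L) - ∫ s in R..r, s ^ (-L) * ((L - 1) * x)) = x * r := by
    intro x r hr
    have h0 : (0:ℝ) ∉ uIcc R r := by
      rw [uIcc_of_ge hr.2]; exact fun h => absurd h.1 (not_le.2 hr.1)
    rw [intervalIntegral.integral_mul_const, integral_rpow (Or.inr ⟨by linarith, h0⟩)]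
    have h1 : (-L + 1) ≠ 0 := by linarith
    have h2 : (r ^ (-L + 1) - R ^ (-L + 1)) / (-L + 1) * ((L - 1) * x)
        = - (r ^ (-L + 1) - R ^ (-L + 1)) * x := by field_simp; ring
    rw [h2, show (1 - L) = -L + 1 by ring]
    have h3 : r ^ L * r ^ (-L + 1) = r := by
      rw [← Real.rpow_add hr.1]; simp
    linear_combination x * h3
  obtain ⟨V, hVc, hVw, hVi, hV⟩ := exists_fixedPoint_of_monotone (C := a * R ^ (1 - L)) (e := R)
    (A := fun r => r ^ L) (B := fun s => s ^ (-L) * (B + L * b))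
    (H := fun v s => s ^ (-L) * (Φ v s - L * v / s)) hab (hpc L)
    (by
      have h2 : ContinuousOn (fun z : ℝ × ℝ => z.2) (wedge a b R) := continuousOn_snd
      refine (h2.rpow_const fun z hz => Or.inl hz.1.1.ne').mul (hΦ.sub ?_)
      exact (continuousOn_const.mul continuousOn_fst).div h2 fun z hz => hz.1.1.ne')
    he (hpi _ _)
    (by
      rintro ⟨v, s⟩ hz
      have hs : 0 < s := hz.1.1
      have hv : 0 ≤ v := le_trans (by positivity) hz.2.1
      have h1 : L * v / s ≤ L * b := by
        rw [div_le_iff₀ hs]; nlinarith [hz.2.2]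
      have h2 : 0 ≤ L * v / s := by positivity
      rw [abs_mul, abs_of_pos (Real.rpow_pos_of_pos hs _)]
      refine mul_le_mul_of_nonneg_left ?_ (Real.rpow_pos_of_pos hs _).le
      calc |Φ v s - L * v / s| ≤ |Φ v s| + |L * v / s| := abs_sub _ _
        _ ≤ B + L * b := by rw [abs_of_nonneg h2]; exact add_le_add (hB _ hz) h1)
    (by
      intro V _ hVw hVi r hr
      have hkey : ∀ s ∈ Ioo r R, (L - 1) * a ≤ L * V s / s - Φ (V s) s ∧
          L * V s / s - Φ (V s) s ≤ (L - 1) * b := by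
        intro s hs
        have hs' : s ∈ Ioc 0 R := ⟨hr.1.trans hs.1, hs.2.le⟩
        have h1 := hanti s hs' ⟨le_rfl, hle s hs'⟩ (hVw s hs') (hVw s hs').1
        have h2 := hanti s hs' (hVw s hs') ⟨hle s hs', le_rfl⟩ (hVw s hs').2
        have e1 : L * (a * s) / s = L * a := by field_simp [hs'.1.ne']
        have e2 : L * (b * s) / s = L * b := by field_simp [hs'.1.ne']
        simp only [e1, e2] at h1 h2
        constructor
        · linarith [hlo s hs']
        · linarith [hhi s hs']
      have hlow : ∫ s in r..R, s ^ (-L) * (Φ (V s) s - L * V s / s) ≤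
          ∫ s in r..R, s ^ (-L) * (-((L - 1) * a)) := by
        refine intervalIntegral.integral_mono_on_of_le_Ioo hr.2 (hVi r hr).symm
          (hpi _ _ r hr).symm fun s hs => ?_
        exact mul_le_mul_of_nonneg_left (by linarith [(hkey s hs).1])
          (Real.rpow_nonneg (hr.1.trans hs.1).le _)
      have hup : ∫ s in r..R, s ^ (-L) * (-((L - 1) * b)) ≤
          ∫ s in r..R, s ^ (-L) * (Φ (V s) s - L * V s / s) := by
        refine intervalIntegral.integral_mono_on_of_le_Ioo hr.2
          (hpi _ _ r hr).symm (hVi r hr).symm fun s hs => ?_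
        exact mul_le_mul_of_nonneg_left (by linarith [(hkey s hs).2])
          (Real.rpow_nonneg (hr.1.trans hs.1).le _)
      simp only [mul_neg, intervalIntegral.integral_neg] at hlow hup
      rw [intervalIntegral.integral_symm, intervalIntegral.integral_symm R r] at hlow hup
      have hp := (Real.rpow_pos_of_pos hr.1 L).le
      have hpR := (Real.rpow_pos_of_pos hR (1 - L)).le
      constructor
      · rw [← hedge a r hr]
        exact mul_le_mul_of_nonneg_left (by linarith) hp
      · rw [← hedge b r hr]
        exact mul_le_mul_of_nonneg_left (by nlinarith) hp)
    (by
      intro V W hVw hWw hVi hWi hVW r hr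
      refine mul_le_mul_of_nonneg_left ?_ (Real.rpow_nonneg hr.1.le _)
      rw [intervalIntegral.integral_symm, intervalIntegral.integral_symm r R]
      have : ∫ s in r..R, s ^ (-L) * (Φ (W s) s - L * W s / s) ≤
          ∫ s in r..R, s ^ (-L) * (Φ (V s) s - L * V s / s) := by
        refine intervalIntegral.integral_mono_on_of_le_Ioo hr.2 (hWi r hr).symm
          (hVi r hr).symm fun s hs => ?_
        have hs' : s ∈ Ioc 0 R := ⟨hr.1.trans hs.1, hs.2.le⟩
        have := hanti s hs' (hVw s hs') (hWw s hs') (hVW s hs')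
        exact mul_le_mul_of_nonneg_left (by simp only at this; linarith)
          (Real.rpow_nonneg hs'.1.le _)
      linarith)
  refine ⟨V, fun r hr => hVw r ⟨hr.1, hr.2.le⟩, fun r hr => ?_⟩
  have hr' : r ∈ Ioc 0 R := ⟨hr.1, hr.2.le⟩
  have hVc' : ContinuousOn V (Ioo 0 R) := hVc.mono Ioo_subset_Ioc_self
  have hc : ContinuousOn (fun s => s ^ (-L) * (Φ (V s) s - L * V s / s)) (Ioo 0 R) := by
    refine ((hpc _).mono Ioo_subset_Ioc_self).mul (ContinuousOn.sub ?_ ?_)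
    · exact hΦ.comp (hVc'.prodMk continuousOn_id)
        fun r hr => ⟨⟨hr.1, hr.2.le⟩, hVw r ⟨hr.1, hr.2.le⟩⟩
    · exact (continuousOn_const.mul hVc').div continuousOn_id fun s hs => hs.1.ne'
  have hd := intervalIntegral.integral_hasDerivAt_right (hVi r hr')
    (hc.stronglyMeasurableAtFilter isOpen_Ioo r hr) (hc.continuousAt (Ioo_mem_nhds hr.1 hr.2))
  have hd2 := (Real.hasDerivAt_rpow_const (p := L) (Or.inl hr.1.ne')).mul
    (hd.const_add (a * R ^ (1 - L)))
  have hVr := hV r hr'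
  refine (hd2.congr_of_eventuallyEq ?_).congr_deriv ?_
  · filter_upwards [Ioo_mem_nhds hr.1 hr.2] with s hs
    exact hV s ⟨hs.1, hs.2.le⟩
  · have h1 : r ^ L * r ^ (-L) = 1 := by rw [← Real.rpow_add hr.1]; simp
    have h2 : r ^ (L - 1) = r ^ L / r := by rw [Real.rpow_sub hr.1, Real.rpow_one]
    rw [h2]
    have h3 : L * (r ^ L / r) * (a * R ^ (1 - L) +
        ∫ s in R..r, s ^ (-L) * (Φ (V s) s - L * V s / s)) = L * V r / r := by
      conv_rhs => rw [hVr]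
      ring
    rw [h3, ← mul_assoc, h1]; ring

/-! ### The direction of solutions at the tip of the wedge -/

/-- A nonnegative function that decreases at a definite rate whenever it is at least `δ` is
eventually at most `δ`. -/
theorem eventually_le_of_deriv_le_neg {W W' : ℝ → ℝ} {S δ η : ℝ} (hη : 0 < η)
    (hW : ∀ s, S < s → HasDerivAt W (W' s) s) (h0 : ∀ s, S < s → 0 ≤ W s)
    (hδ : ∀ s, S < s → δ ≤ W s → W' s ≤ -η) : ∀ᶠ s in atTop, W s ≤ δ := by
  obtain ⟨s₁, hs₁, hlt⟩ : ∃ s₁, S < s₁ ∧ W s₁ < δ := by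
    by_contra! hcon
    have hanti : ∀ s, S + 1 ≤ s → W s ≤ W (S + 1) - η * (s - (S + 1)) := by
      intro s hs
      refine image_le_of_deriv_right_le_deriv_boundary (f := W) (f' := W')
        (B := fun s => W (S + 1) - η * (s - (S + 1))) (B' := fun _ => -η)
        (a := S + 1) (b := s)
        (fun x hx => (hW x (by linarith [hx.1])).continuousAt.continuousWithinAt)
        (fun x hx => (hW x (by linarith [hx.1])).hasDerivWithinAt) (by simp)
        (by fun_prop) (fun x _ => ?_) (fun x hx => ?_) ⟨hs, le_rfl⟩
      · have := (((hasDerivAt_id x).sub_const (S + 1)).const_mul η).const_sub (W (S + 1))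
        simpa using this.hasDerivWithinAt
      · exact hδ x (by linarith [hx.1]) (hcon x (by linarith [hx.1]))
    have hpos : 0 ≤ W (S + 1) := h0 _ (by linarith)
    have h1 := hanti (S + 1 + (W (S + 1) + 1) / η) (by
      have : 0 ≤ (W (S + 1) + 1) / η := by positivity
      linarith)
    have h2 := h0 (S + 1 + (W (S + 1) + 1) / η) (by
      have : 0 ≤ (W (S + 1) + 1) / η := by positivity
      linarith)
    have h3 : η * (S + 1 + (W (S + 1) + 1) / η - (S + 1)) = W (S + 1) + 1 := by
      field_simp; ring
    linarith
  filter_upwards [eventually_ge_atTop s₁] with s hs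
  exact image_le_of_deriv_right_lt_deriv_boundary (f := W) (f' := W') (B := fun _ => δ)
    (B' := fun _ => 0) (a := s₁) (b := s)
    (fun x hx => (hW x (hs₁.trans_le hx.1)).continuousAt.continuousWithinAt)
    (fun x hx => (hW x (hs₁.trans_le hx.1)).hasDerivWithinAt) hlt.le
    (fun x => hasDerivAt_const x δ)
    (fun x hx h => by linarith [hδ x (hs₁.trans_le hx.1) h.ge]) ⟨hs, le_rfl⟩

/-- A function that is bounded above and increases at a definite rate whenever it is at least `δ`
stays below `δ`. -/
theorem lt_of_le_deriv {W W' : ℝ → ℝ} {S δ η B : ℝ} (hη : 0 < η)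
    (hW : ∀ s, S < s → HasDerivAt W (W' s) s) (hB : ∀ s, S < s → W s ≤ B)
    (hδ : ∀ s, S < s → δ ≤ W s → η ≤ W' s) : ∀ s, S < s → W s < δ := by
  intro s₁ hs₁
  by_contra! hge
  have hstay : ∀ s, s₁ ≤ s → δ ≤ W s := by
    intro s hs
    have := image_le_of_deriv_right_lt_deriv_boundary (f := fun x => -W x) (f' := fun x => -W' x)
      (B := fun _ => -δ) (B' := fun _ => 0) (a := s₁) (b := s)
      (fun x hx => (hW x (hs₁.trans_le hx.1)).neg.continuousAt.continuousWithinAt)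
      (fun x hx => (hW x (hs₁.trans_le hx.1)).neg.hasDerivWithinAt) (neg_le_neg hge)
      (fun x => hasDerivAt_const x (-δ))
      (fun x hx h => by
        have := hδ x (hs₁.trans_le hx.1) (by linarith)
        linarith) ⟨hs, le_rfl⟩
    linarith
  have hgrow : ∀ s, s₁ ≤ s → W s₁ + η * (s - s₁) ≤ W s := by
    intro s hs
    refine image_le_of_deriv_right_le_deriv_boundary (B := W) (B' := W')
      (f := fun s => W s₁ + η * (s - s₁)) (f' := fun _ => η) (a := s₁) (b := s)
      (by fun_prop) (fun x _ => ?_) (by simp)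
      (fun x hx => (hW x (hs₁.trans_le hx.1)).continuousAt.continuousWithinAt)
      (fun x hx => (hW x (hs₁.trans_le hx.1)).hasDerivWithinAt) (fun x hx => ?_) ⟨hs, le_rfl⟩
    · have := (((hasDerivAt_id x).sub_const s₁).const_mul η).const_add (W s₁)
      simpa using this.hasDerivWithinAt
    · exact hδ x (hs₁.trans_le hx.1) (hstay x hx.1)
  have hpos : 0 ≤ (B - W s₁ + 1) / η := by
    have := hB s₁ hs₁
    apply div_nonneg <;> linarith
  have h1 := hgrow (s₁ + (B - W s₁ + 1) / η) (by linarith)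
  have h2 := hB (s₁ + (B - W s₁ + 1) / η) (by linarith)
  have h3 : η * (s₁ + (B - W s₁ + 1) / η - s₁) = B - W s₁ + 1 := by field_simp; ring
  linarith

/-- A solution of `V' = Φ (V, r)` that stays in the wedge `a r ≤ v ≤ b r` leaves the tip in the
direction `X₀`, provided that the limiting slope `f` at the tip differs from the direction, with a
definite sign of `(f X - X) (X - X₀)`, for every other direction `X` of the wedge. In the logarithmic
variable `s = -log r`, the squared deviation of `V / r` from `X₀` is bounded and strictly monotone
outside each neighbourhood of zero. -/
theorem tendsto_div_of_sign {a b R X₀ σ : ℝ} {Φ : ℝ → ℝ → ℝ} {V f : ℝ → ℝ} (hR : 0 < R)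
    (hσ : σ = 1 ∨ σ = -1)
    (hV : ∀ r ∈ Ioo 0 R, V r ∈ Icc (a * r) (b * r))
    (hV' : ∀ r ∈ Ioo 0 R, HasDerivAt V (Φ (V r) r) r)
    (hf : ∀ X ∈ Icc a b, Tendsto (fun z : ℝ × ℝ => Φ (z.1 * z.2) z.2) (𝓝 X ×ˢ 𝓝[>] 0) (𝓝 (f X)))
    (hsign : ∀ X ∈ Icc a b, X ≠ X₀ → 0 < σ * ((f X - X) * (X - X₀))) :
    Tendsto (fun r => V r / r) (𝓝[>] 0) (𝓝 X₀) := by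
  -- The rate of change of the squared deviation, as a function of direction and radius.
  set D : ℝ × ℝ → ℝ := fun z => σ * ((Φ (z.1 * z.2) z.2 - z.1) * (z.1 - X₀)) with hD
  have hDlim : ∀ X ∈ Icc a b, Tendsto D (𝓝 X ×ˢ 𝓝[>] 0)
      (𝓝 (σ * ((f X - X) * (X - X₀)))) := fun X hX =>
    (((hf X hX).sub tendsto_fst).mul (tendsto_fst.sub_const X₀)).const_mul σ
  have hrate : ∀ δ > 0, ∃ η > 0, ∀ᶠ r in 𝓝[>] 0, ∀ x ∈ Icc a b, δ ≤ (x - X₀) ^ 2 →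
      η ≤ D (x, r) := by
    intro δ hδ
    set K : Set ℝ := Icc a b ∩ {x | δ ≤ (x - X₀) ^ 2} with hK
    have hKc : IsCompact K := isCompact_Icc.inter_right
      (isClosed_le continuous_const (by fun_prop))
    have hne : ∀ x ∈ K, x ≠ X₀ := by
      rintro x hx rfl
      have := hx.2
      simp at this
      linarith
    have hloc : ∀ x ∈ K, ∃ t ∈ 𝓝[K] x, ∃ η > 0, ∀ᶠ r in 𝓝[>] (0:ℝ), ∀ y ∈ t, η ≤ D (y, r) := by
      intro x hx
      have hp := hsign x hx.1 (hne x hx)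
      have hev := (hDlim x hx.1).eventually (lt_mem_nhds (half_lt_self hp))
      obtain ⟨P, hP, Q, hQ, hPQ⟩ := eventually_prod_iff.1 hev
      refine ⟨{y | P y}, mem_nhdsWithin_of_mem_nhds hP, _, half_pos hp, ?_⟩
      filter_upwards [hQ] with r hr y hy
      exact (hPQ hy hr).le
    have := hKc.induction_on (p := fun t => ∃ η > 0, ∀ᶠ r in 𝓝[>] (0:ℝ), ∀ y ∈ t, η ≤ D (y, r))
      ⟨1, one_pos, by simp⟩
      (fun s t hst ⟨η, h1, h2⟩ => ⟨η, h1, h2.mono fun r hr y hy => hr y (hst hy)⟩)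
      (fun s t ⟨η, h1, h2⟩ ⟨η', h1', h2'⟩ => ⟨min η η', lt_min h1 h1', by
        filter_upwards [h2, h2'] with r hr hr' y hy
        rcases hy with hy | hy
        · exact (min_le_left _ _).trans (hr y hy)
        · exact (min_le_right _ _).trans (hr' y hy)⟩)
      hloc
    obtain ⟨η, h1, h2⟩ := this
    exact ⟨η, h1, h2.mono fun r hr x hx hxd => hr x ⟨hx, hxd⟩⟩
  set y : ℝ → ℝ := fun s => V (Real.exp (-s)) / Real.exp (-s) with hy
  have hexp : ∀ s, -Real.log R < s → Real.exp (-s) ∈ Ioo 0 R := fun s hs =>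
    ⟨Real.exp_pos _, by rw [← Real.lt_log_iff_exp_lt hR]; linarith⟩
  have hyI : ∀ s, -Real.log R < s → y s ∈ Icc a b := fun s hs => by
    have h := hV _ (hexp s hs)
    exact ⟨(le_div_iff₀ (Real.exp_pos _)).2 h.1, (div_le_iff₀ (Real.exp_pos _)).2 h.2⟩
  have hyd : ∀ s, -Real.log R < s → HasDerivAt (fun s => (y s - X₀) ^ 2)
      (-2 * σ * D (y s, Real.exp (-s))) s := by
    intro s hs
    have he : HasDerivAt (fun s => Real.exp (-s)) (-Real.exp (-s)) s := by
      simpa using (hasDerivAt_neg s).exp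
    have h1 := (((hV' _ (hexp s hs)).comp s he).div he (Real.exp_pos _).ne').sub_const X₀ |>.pow 2
    refine h1.congr_deriv ?_
    have hmul : V (Real.exp (-s)) / Real.exp (-s) * Real.exp (-s) = V (Real.exp (-s)) :=
      div_mul_cancel₀ _ (Real.exp_pos _).ne'
    have hσ2 : σ ^ 2 = 1 := by rcases hσ with rfl | rfl <;> norm_num
    have hp := (Real.exp_pos (-s)).ne'
    simp only [hD, hy, hmul, Function.comp_apply, Pi.div_apply, Nat.add_one_sub_one,
      pow_one, Nat.cast_ofNat]
    field_simp
    rw [hσ2]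
    ring
  have hylim : Tendsto (fun s => (y s - X₀) ^ 2) atTop (𝓝 0) := by
    refine Metric.tendsto_nhds.2 fun ε hε => ?_
    obtain ⟨η, hη, hev⟩ := hrate (ε / 2) (half_pos hε)
    have hev' : ∀ᶠ s in atTop, ∀ x ∈ Icc a b, ε / 2 ≤ (x - X₀) ^ 2 → η ≤ D (x, Real.exp (-s)) := by
      have ht : Tendsto (fun s => Real.exp (-s)) atTop (𝓝[>] 0) :=
        tendsto_nhdsWithin_iff.2 ⟨Real.tendsto_exp_neg_atTop_nhds_zero,
          Eventually.of_forall fun s => Real.exp_pos _⟩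
      exact ht.eventually hev
    obtain ⟨S, hS⟩ := eventually_atTop.1 (hev'.and (eventually_gt_atTop (-Real.log R)))
    have hle : ∀ᶠ s in atTop, (y s - X₀) ^ 2 ≤ ε / 2 := by
      rcases hσ with rfl | rfl
      · refine eventually_le_of_deriv_le_neg (η := η) (S := S) hη
          (fun s hs => hyd s (hS s hs.le).2) (fun s _ => sq_nonneg _) fun s hs h => ?_
        have := (hS s hs.le).1 _ (hyI s (hS s hs.le).2) h
        linarith
      · filter_upwards [eventually_gt_atTop S] with s hs
        refine (lt_of_le_deriv (η := η) (S := S) (B := (a - X₀) ^ 2 + (b - X₀) ^ 2) hη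
          (fun s hs => hyd s (hS s hs.le).2) (fun s hs => ?_) (fun s hs h => ?_) s hs).le
        · have := hyI s (hS s hs.le).2
          rcases le_total (y s) X₀ with h | h
          · nlinarith [this.1, sq_nonneg (b - X₀)]
          · nlinarith [this.2, sq_nonneg (a - X₀)]
        · have := (hS s hs.le).1 _ (hyI s (hS s hs.le).2) h
          linarith
    filter_upwards [hle] with s hs
    rw [Real.dist_eq, sub_zero, abs_of_nonneg (sq_nonneg _)]
    linarith
  have hylim' : Tendsto y atTop (𝓝 X₀) := by
    have h1 := hylim.sqrt
    simp only [Real.sqrt_sq_eq_abs, Real.sqrt_zero] at h1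
    exact tendsto_iff_dist_tendsto_zero.2 (by simpa [Real.dist_eq] using h1)
  have hlog : Tendsto (fun r => -Real.log r) (𝓝[>] 0) atTop :=
    tendsto_neg_atBot_atTop.comp Real.tendsto_log_nhdsGT_zero
  refine (hylim'.comp hlog).congr' ?_
  filter_upwards [self_mem_nhdsWithin] with r hr
  simp [hy, Real.exp_log hr]

/-! ### Affine parametrisation -/

/-- A strictly increasing reparametrisation `k` of `(0, ε)` with positive derivative `g` that starts
at `k = 0` has an inverse, which solves `ρ' = 1 / g ρ`. -/
theorem exists_inverse_parametrisation {ε : ℝ} {k g : ℝ → ℝ} (hε : 0 < ε) (hk0 : k 0 = 0)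
    (hkc : ContinuousOn k (Icc 0 ε)) (hk : ∀ r ∈ Ioo 0 ε, HasDerivAt k (g r) r)
    (hg : ∀ r ∈ Ioo 0 ε, 0 < g r) :
    ∃ b > 0, ∃ ρ : ℝ → ℝ, ρ '' Ioo 0 b = Ioo 0 ε ∧
      (∀ t ∈ Ioo 0 b, HasDerivAt ρ (g (ρ t))⁻¹ t) ∧ Tendsto ρ (𝓝[>] 0) (𝓝 0) := by
  have hmono : StrictMonoOn k (Icc 0 ε) := by
    refine strictMonoOn_of_deriv_pos (convex_Icc 0 ε) hkc fun r hr => ?_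
    rw [interior_Icc] at hr
    rw [(hk r hr).deriv]
    exact hg r hr
  have h0 : (0:ℝ) ∈ Icc 0 ε := left_mem_Icc.2 hε.le
  have h1 : ε ∈ Icc 0 ε := right_mem_Icc.2 hε.le
  have hb : 0 < k ε := hk0 ▸ hmono h0 h1 hε
  have hsurj : ∀ t ∈ Ioo 0 (k ε), ∃ r ∈ Ioo 0 ε, k r = t := fun t ht => by
    have := intermediate_value_Ioo hε.le hkc
    rw [hk0] at this
    exact this ht
  choose! ρ hρ hkρ using hsurj
  have himg : ρ '' Ioo 0 (k ε) = Ioo 0 ε := by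
    refine Subset.antisymm (image_subset_iff.2 hρ) fun r hr => ?_
    have hr' := Ioo_subset_Icc_self hr
    have ht : k r ∈ Ioo 0 (k ε) := ⟨hk0 ▸ hmono h0 hr' hr.1, hmono hr' h1 hr.2⟩
    exact ⟨k r, ht, hmono.injOn (Ioo_subset_Icc_self (hρ _ ht)) hr' (hkρ _ ht)⟩
  have hρmono : StrictMonoOn ρ (Ioo 0 (k ε)) := fun s hs t ht hst => by
    rw [← hmono.lt_iff_lt (Ioo_subset_Icc_self (hρ s hs)) (Ioo_subset_Icc_self (hρ t ht)),
      hkρ s hs, hkρ t ht]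
    exact hst
  refine ⟨k ε, hb, ρ, himg, fun t ht => ?_, ?_⟩
  · have hnhds := Ioo_mem_nhds ht.1 ht.2
    have hc : ContinuousAt ρ t := hρmono.continuousAt_of_image_mem_nhds hnhds
      (himg ▸ Ioo_mem_nhds (hρ t ht).1 (hρ t ht).2)
    exact HasDerivAt.of_local_left_inverse hc (hk _ (hρ t ht)) (hg _ (hρ t ht)).ne'
      (by filter_upwards [hnhds] with s hs using hkρ s hs)
  · refine tendsto_order.2 ⟨fun x hx => ?_, fun x hx => ?_⟩
    · filter_upwards [Ioo_mem_nhdsGT hb] with t ht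
      exact hx.trans (hρ t ht).1
    · obtain ⟨y, hy0, hy⟩ := exists_between (lt_min hx hε)
      have hyI : y ∈ Icc 0 ε := ⟨hy0.le, (hy.trans_le (min_le_right _ _)).le⟩
      have hky : 0 < k y := hk0 ▸ hmono h0 hyI hy0
      filter_upwards [Ioo_mem_nhdsGT hb, Ioo_mem_nhdsGT hky] with t ht ht'
      refine lt_trans ?_ (hy.trans_le (min_le_left _ _))
      rw [← hmono.lt_iff_lt (Ioo_subset_Icc_self (hρ t ht)) hyI, hkρ t ht]
      exact ht'.2

/-- The affine parametrisation of an outgoing radial null curve on which the lapse is `a r` and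
its logarithmic radial derivative is `α r`. As a function of `r`, the velocity `u = dv/dk` solves
`u' = -α u`, and `dk/dr = 2 / (a u)`. The bound `-1 / (2 r) ≤ α r` makes `1 / u` grow no faster than
`r ^ (-1/2)`, so that the affine parameter at the singularity is finite. -/
theorem exists_affine_parametrisation {ε κ : ℝ} {a α : ℝ → ℝ} (hε : 0 < ε) (hκ : 0 < κ)
    (ha : ContinuousOn a (Ioc 0 ε)) (haκ : ∀ r ∈ Ioc 0 ε, κ ≤ a r)
    (hα : ContinuousOn α (Ioc 0 ε)) (hα' : ∀ r ∈ Ioc 0 ε, -(1 / (2 * r)) ≤ α r) :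
    ∃ u : ℝ → ℝ, (∀ r ∈ Ioo 0 ε, 0 < u r ∧ HasDerivAt u (-α r * u r) r) ∧
      ∃ b > 0, ∃ ρ : ℝ → ℝ, ρ '' Ioo 0 b = Ioo 0 ε ∧
        (∀ t ∈ Ioo 0 b, HasDerivAt ρ (a (ρ t) * u (ρ t) / 2) t) ∧ Tendsto ρ (𝓝[>] 0) (𝓝 0) := by
  have hαi : ∀ r ∈ Ioc 0 ε, IntervalIntegrable α MeasureTheory.volume ε r := fun r hr => by
    refine (hα.mono ?_).intervalIntegrable
    rw [uIcc_of_ge hr.2]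
    exact fun s hs => ⟨hr.1.trans_le hs.1, hs.2⟩
  set u : ℝ → ℝ := fun r => Real.exp (-∫ s in ε..r, α s) with hu
  have hupos : ∀ r, 0 < u r := fun r => Real.exp_pos _
  have huc : ContinuousOn u (Ioc 0 ε) :=
    Real.continuous_exp.comp_continuousOn (continuousOn_primitive_Ioc hαi).neg
  have hud : ∀ r ∈ Ioo 0 ε, HasDerivAt u (-α r * u r) r := fun r hr => by
    have hα₀ := hα.mono (Ioo_subset_Ioc_self : Ioo 0 ε ⊆ _)
    have hd := intervalIntegral.integral_hasDerivAt_right (hαi r ⟨hr.1, hr.2.le⟩)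
      (hα₀.stronglyMeasurableAtFilter isOpen_Ioo r hr) (hα₀.continuousAt (Ioo_mem_nhds hr.1 hr.2))
    exact hd.neg.exp.congr_deriv (mul_comm _ _)
  set g : ℝ → ℝ := fun r => 2 / (a r * u r) with hg
  have hapos : ∀ r ∈ Ioc 0 ε, 0 < a r := fun r hr => hκ.trans_le (haκ r hr)
  have hgpos : ∀ r ∈ Ioc 0 ε, 0 < g r := fun r hr =>
    div_pos two_pos (mul_pos (hapos r hr) (hupos r))
  have hgc : ContinuousOn g (Ioc 0 ε) := continuousOn_const.div (ha.mul huc)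
    fun r hr => (mul_pos (hapos r hr) (hupos r)).ne'
  have huinv : ∀ r ∈ Ioc 0 ε, (u r)⁻¹ ≤ ε ^ (1 / 2 : ℝ) * r ^ (-(1 / 2) : ℝ) := by
    intro r hr
    have h0 : (0:ℝ) ∉ uIcc r ε := by
      rw [uIcc_of_le hr.2]; exact fun h => absurd h.1 (not_le.2 hr.1)
    have hint : ∫ s in r..ε, -(1 / 2 * (1 / s)) ≤ ∫ s in r..ε, α s := by
      refine intervalIntegral.integral_mono_on_of_le_Ioo hr.2 ?_ (hαi r hr).symm fun s hs => ?_
      · exact ((intervalIntegral.intervalIntegrable_one_div (fun s hs h => h0 (h ▸ hs))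
          continuousOn_id).const_mul _).neg
      · have := hα' s ⟨hr.1.trans hs.1, hs.2.le⟩
        rwa [one_div_mul_one_div]
    rw [intervalIntegral.integral_neg, intervalIntegral.integral_const_mul,
      integral_one_div h0, Real.log_div hε.ne' hr.1.ne'] at hint
    rw [hu, Real.rpow_def_of_pos hε, Real.rpow_def_of_pos hr.1, ← Real.exp_neg, ← Real.exp_add]
    refine Real.exp_le_exp.2 ?_
    rw [intervalIntegral.integral_symm]
    linarith
  have hgle : ∀ r ∈ Ioc 0 ε, g r ≤ 2 / κ * ε ^ (1 / 2 : ℝ) * r ^ (-(1 / 2) : ℝ) := fun r hr => by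
    have e : g r = 2 / a r * (u r)⁻¹ := by rw [hg]; field_simp
    rw [e, mul_assoc]
    exact mul_le_mul (div_le_div_of_nonneg_left two_pos.le hκ (haκ r hr)) (huinv r hr)
      (inv_pos.2 (hupos r)).le (by positivity)
  have hgi : ∀ r ∈ Ioc 0 ε, IntervalIntegrable g MeasureTheory.volume 0 r := fun r hr => by
    have hsub : uIoc 0 r ⊆ Ioc 0 ε := by
      rw [uIoc_of_le hr.1.le]; exact Ioc_subset_Ioc_right hr.2
    refine ((intervalIntegral.intervalIntegrable_rpow' (a := 0) (b := r)
      (r := -(1 / 2)) (by norm_num)).const_mul (2 / κ * ε ^ (1 / 2 : ℝ))).mono_fun'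
      ((hgc.mono hsub).aestronglyMeasurable measurableSet_uIoc)
      ((MeasureTheory.ae_restrict_iff' measurableSet_uIoc).2 <| Eventually.of_forall fun s hs => ?_)
    beta_reduce
    rw [Real.norm_of_nonneg (hgpos s (hsub hs)).le]
    exact hgle s (hsub hs)
  have hgc' := hgc.mono (Ioo_subset_Ioc_self : Ioo 0 ε ⊆ _)
  obtain ⟨b, hb, ρ, himg, hρ, hρ0⟩ := exists_inverse_parametrisation (g := g)
    (k := fun r => ∫ s in (0:ℝ)..r, g s) hε (by simp)
    (by
      have := intervalIntegral.continuousOn_primitive_interval' (hgi ε ⟨hε, le_rfl⟩) left_mem_uIcc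
      rwa [uIcc_of_le hε.le] at this)
    (fun r hr => intervalIntegral.integral_hasDerivAt_right (hgi r ⟨hr.1, hr.2.le⟩)
      (hgc'.stronglyMeasurableAtFilter isOpen_Ioo r hr) (hgc'.continuousAt (Ioo_mem_nhds hr.1 hr.2)))
    (fun r hr => hgpos r ⟨hr.1, hr.2.le⟩)
  refine ⟨u, fun r hr => ⟨hupos r, hud r hr⟩, b, hb, ρ, himg, fun t ht => ?_, hρ0⟩
  refine (hρ t ht).congr_deriv ?_
  rw [hg, inv_div]

/-! ### The mass function near the singularity -/

section Mass

variable {N : ℕ} {m : ℝ → ℝ → ℝ} {U : Set (ℝ × ℝ)} {c : ℝ} {p q : ℝ → ℝ}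

/-- In the coordinates `(x, r) = (v / r, r)`, the approach to the singularity in the direction `X`
is the approach to the point `(X, 0)` with `r > 0`. -/
theorem tendsto_towards (X : ℝ) :
    Tendsto (fun z : ℝ × ℝ => (z.1 * z.2, z.2)) (𝓝 X ×ˢ 𝓝[>] 0) (towards X) := by
  have hle : 𝓝 X ×ˢ 𝓝[>] (0:ℝ) ≤ 𝓝 (X, 0) := by
    rw [nhds_prod_eq]; exact prod_mono le_rfl nhdsWithin_le_nhds
  have hpos : ∀ᶠ z : ℝ × ℝ in 𝓝 X ×ˢ 𝓝[>] 0, 0 < z.2 :=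
    tendsto_snd.eventually self_mem_nhdsWithin
  refine tendsto_inf.2 ⟨tendsto_inf.2 ⟨?_, tendsto_principal.2 hpos⟩, tendsto_comap_iff.2 ?_⟩
  · have : Continuous fun z : ℝ × ℝ => (z.1 * z.2, z.2) := by fun_prop
    simpa using (this.tendsto (X, 0)).mono_left hle
  · refine (tendsto_fst (f := 𝓝 X) (g := 𝓝[>] (0:ℝ))).congr' ?_
    filter_upwards [hpos] with z hz
    simp [hz.ne']

/-- The straight ray `v = X r` approaches the singularity in the direction `X`. -/
theorem tendsto_ray_towards (X : ℝ) :
    Tendsto (fun r : ℝ => (X * r, r)) (𝓝[>] 0) (towards X) :=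
  (tendsto_towards X).comp (tendsto_const_nhds.prodMk tendsto_id)

namespace IsCollapsing

variable (h : IsCollapsing N m U c)
include h

theorem differentiableAt {v r : ℝ} (hz : (v, r) ∈ U) :
    DifferentiableAt ℝ (fun p : ℝ × ℝ => m p.1 p.2) (v, r) :=
  (h.contDiff.differentiableOn one_ne_zero).differentiableAt (h.isOpen.mem_nhds hz)

theorem mDot_eq {v r : ℝ} (hz : (v, r) ∈ U) :
    mDot m v r = fderiv ℝ (fun p : ℝ × ℝ => m p.1 p.2) (v, r) (1, 0) := by
  have hd := (h.differentiableAt hz).hasFDerivAt.comp_hasDerivAt (f := fun s => (s, r)) v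
    ((hasDerivAt_id v).prodMk (hasDerivAt_const v r))
  exact hd.deriv

theorem mPrime_eq {v r : ℝ} (hz : (v, r) ∈ U) :
    mPrime m v r = fderiv ℝ (fun p : ℝ × ℝ => m p.1 p.2) (v, r) (0, 1) := by
  have hd := (h.differentiableAt hz).hasFDerivAt.comp_hasDerivAt (f := fun s => (v, s)) r
    ((hasDerivAt_const r v).prodMk (hasDerivAt_id r))
  exact hd.deriv

/-- The chain rule for the mass function along a curve. -/
theorem hasDerivAt_mass {v r : ℝ → ℝ} {v' r' k : ℝ} (hz : (v k, r k) ∈ U)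
    (hv : HasDerivAt v v' k) (hr : HasDerivAt r r' k) :
    HasDerivAt (fun t => m (v t) (r t)) (mDot m (v k) (r k) * v' + mPrime m (v k) (r k) * r') k := by
  have hd := (h.differentiableAt hz).hasFDerivAt.comp_hasDerivAt k (hv.prodMk hr)
  refine hd.congr_deriv ?_
  rw [h.mDot_eq hz, h.mPrime_eq hz,
    show (v', r') = v' • ((1:ℝ), (0:ℝ)) + r' • ((0:ℝ), (1:ℝ)) by simp, map_add, map_smul, map_smul]
  simp [mul_comm]

theorem continuousOn_mPrime : ContinuousOn (fun z : ℝ × ℝ => mPrime m z.1 z.2) U :=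
  ((h.contDiff.continuousOn_fderiv_of_isOpen h.isOpen le_rfl).clm_apply
    (continuousOn_const (c := ((0:ℝ), (1:ℝ))))).congr fun _ hz => h.mPrime_eq hz

theorem mDot_nonneg (hN : 4 ≤ N) {v r : ℝ} (hz : (v, r) ∈ U) : 0 ≤ mDot m v r := by
  have h1 : 0 ≤ ((N : ℝ) - 2) * mDot m v r / r ^ (N - 2) := (h.weakStrong _ hz).1
  have hr : 0 < r ^ (N - 2) := pow_pos (h.radius_pos _ hz) _
  have hN' : (4:ℝ) ≤ N := by exact_mod_cast hN
  have h2 := (le_div_iff₀ hr).1 h1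
  rw [zero_mul] at h2
  exact nonneg_of_mul_nonneg_right h2 (by linarith)

theorem eventually_mem {X : ℝ} (hX : X ∈ Ioo 0 c) :
    ∀ᶠ z : ℝ × ℝ in 𝓝 X ×ˢ 𝓝[>] 0, (z.1 * z.2, z.2) ∈ U :=
  (tendsto_towards X).eventually (h.vicinity X hX)

theorem limit_mDot_nonneg (hN : 4 ≤ N) (hlim : HasDerivativeLimits N m c p q) {X : ℝ}
    (hX : X ∈ Ioo 0 c) : 0 ≤ q X := by
  refine ge_of_tendsto ((hlim X hX).2.comp (tendsto_towards X)) ?_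
  filter_upwards [h.eventually_mem hX] with z hz
  exact div_nonneg (h.mDot_nonneg hN hz) (pow_nonneg (h.radius_pos _ hz).le _)

/-- Integration of `dm/dr = m' + X ṁ` along the rays `v = X r`, from zero mass at the singularity,
gives the leading behaviour of the mass function, uniformly for directions near `X`. -/
theorem tendsto_mass_div (hN : 4 ≤ N) (hlim : HasDerivativeLimits N m c p q) {X : ℝ}
    (hX : X ∈ Ioo 0 c) :
    Tendsto (fun z : ℝ × ℝ => m (z.1 * z.2) z.2 / z.2 ^ (N - 3)) (𝓝 X ×ˢ 𝓝[>] 0)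
      (𝓝 ((p X + X * q X) / ((N : ℝ) - 3))) := by
  obtain ⟨n, rfl⟩ : ∃ n, N = n + 4 := ⟨N - 4, by omega⟩
  have e3 : n + 4 - 3 = n + 1 := rfl
  have e4 : n + 4 - 4 = n := rfl
  have ec : ((n + 4 : ℕ) : ℝ) - 3 = n + 1 := by push_cast; ring
  rw [e3, ec]
  set l : ℝ := (p X + X * q X) / (n + 1) with hl
  have hn : (0:ℝ) < n + 1 := by positivity
  have hd : Tendsto (fun z : ℝ × ℝ => mPrime m (z.1 * z.2) z.2 / z.2 ^ n +
      z.1 * (mDot m (z.1 * z.2) z.2 / z.2 ^ n)) (𝓝 X ×ˢ 𝓝[>] 0) (𝓝 (p X + X * q X)) :=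
    ((hlim X hX).1.comp (tendsto_towards X)).add
      (tendsto_fst.mul ((hlim X hX).2.comp (tendsto_towards X)))
  refine Metric.tendsto_nhds.2 fun ε hε => ?_
  have hev := (Metric.tendsto_nhds.1 hd (ε / 2 * (n + 1)) (by positivity)).and
    ((h.eventually_mem hX).and (tendsto_fst.eventually (Ioo_mem_nhds hX.1 hX.2)))
  obtain ⟨P, hP, Q, hQ, hPQ⟩ := eventually_prod_iff.1 hev
  obtain ⟨δ, hδ, hδQ⟩ := mem_nhdsGT_iff_exists_Ioo_subset.1 hQ
  rw [mem_Ioi] at hδ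
  refine eventually_prod_iff.2 ⟨P, hP, fun r => r ∈ Ioo 0 δ, Ioo_mem_nhdsGT hδ, ?_⟩
  intro x hx r hr
  have hpt : ∀ s ∈ Ioo 0 δ, |mPrime m (x * s) s / s ^ n +
      x * (mDot m (x * s) s / s ^ n) - (p X + X * q X)| < ε / 2 * (n + 1) ∧
      (x * s, s) ∈ U ∧ x ∈ Ioo 0 c := fun s hs => hPQ hx (hδQ hs)
  have hxc := (hpt r hr).2.2
  -- The deviation of the mass from `l r ^ (n + 1)` is controlled by integrating its derivative.
  have hder : ∀ s ∈ Ioo 0 δ, HasDerivAt (fun s => m (x * s) s - l * s ^ (n + 1))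
      (mDot m (x * s) s * x + mPrime m (x * s) s - (p X + X * q X) * s ^ n) s := fun s hs => by
    have h1 := h.hasDerivAt_mass (v := fun s => x * s) (r := fun s => s) (hpt s hs).2.1
      ((hasDerivAt_id s).const_mul x) (hasDerivAt_id s)
    have h2 := (hasDerivAt_pow (n + 1) s).const_mul l
    refine (h1.sub h2).congr_deriv ?_
    rw [hl]; push_cast; simp; field_simp
  have hbd : ∀ s ∈ Ioo 0 δ, |mDot m (x * s) s * x + mPrime m (x * s) s
      - (p X + X * q X) * s ^ n| ≤ ε / 2 * ((n + 1) * s ^ n) := fun s hs => by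
    have hs' : 0 < s ^ n := pow_pos hs.1 n
    have e : mDot m (x * s) s * x + mPrime m (x * s) s - (p X + X * q X) * s ^ n =
      (mPrime m (x * s) s / s ^ n + x * (mDot m (x * s) s / s ^ n) - (p X + X * q X)) * s ^ n := by
      field_simp; ring
    rw [e, abs_mul, abs_of_pos hs', ← mul_assoc]
    exact mul_le_mul_of_nonneg_right (hpt s hs).1.le hs'.le
  have hpow : ∀ s, HasDerivAt (fun s : ℝ => ε / 2 * s ^ (n + 1)) (ε / 2 * ((n + 1) * s ^ n)) s :=
    fun s => by simpa using (hasDerivAt_pow (n + 1) s).const_mul (ε / 2)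
  have hm0 : Tendsto (fun s => m (x * s) s - l * s ^ (n + 1)) (𝓝[>] 0) (𝓝 0) := by
    have h1 := (h.mass_zero x hxc).comp (tendsto_ray_towards x)
    have h2 : Tendsto (fun s : ℝ => l * s ^ (n + 1)) (𝓝[>] 0) (𝓝 0) := by
      have : Continuous fun s : ℝ => l * s ^ (n + 1) := by fun_prop
      simpa using (this.tendsto 0).mono_left nhdsWithin_le_nhds
    simpa using h1.sub h2
  have hp0 : Tendsto (fun s : ℝ => ε / 2 * s ^ (n + 1)) (𝓝[>] 0) (𝓝 0) := by
    have : Continuous fun s : ℝ => ε / 2 * s ^ (n + 1) := by fun_prop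
    simpa using (this.tendsto 0).mono_left nhdsWithin_le_nhds
  have hnonneg : ∀ f f' : ℝ → ℝ, (∀ s ∈ Ioo 0 δ, HasDerivAt f (f' s) s) →
      (∀ s ∈ Ioo 0 δ, 0 ≤ f' s) → Tendsto f (𝓝[>] 0) (𝓝 0) → 0 ≤ f r := by
    intro f f' hf hf' hf0
    have hmono : MonotoneOn f (Ioo 0 δ) := by
      refine monotoneOn_of_deriv_nonneg (convex_Ioo 0 δ)
        (fun s hs => (hf s hs).continuousAt.continuousWithinAt) (fun s hs => ?_) (fun s hs => ?_)
      · rw [interior_Ioo] at hs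
        exact (hf s hs).differentiableAt.differentiableWithinAt
      · rw [interior_Ioo] at hs
        rw [(hf s hs).deriv]
        exact hf' s hs
    refine le_of_tendsto hf0 ?_
    filter_upwards [Ioo_mem_nhdsGT hr.1] with s hs
    exact hmono ⟨hs.1, hs.2.trans hr.2⟩ hr hs.2.le
  have hup := hnonneg _ _ (fun s hs => (hpow s).sub (hder s hs))
    (fun s hs => by linarith [(abs_le.1 (hbd s hs)).2]) ((hp0.sub hm0).trans (le_of_eq <| by rw [sub_zero]))
  have hlow := hnonneg _ _ (fun s hs => (hpow s).add (hder s hs))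
    (fun s hs => by linarith [(abs_le.1 (hbd s hs)).1]) ((hp0.add hm0).trans (le_of_eq <| by rw [add_zero]))
  have hrn : 0 < r ^ (n + 1) := pow_pos hr.1 _
  have hle : |m (x * r) r - l * r ^ (n + 1)| ≤ ε / 2 * r ^ (n + 1) := by
    simp only [Pi.sub_apply, Pi.add_apply] at hup hlow
    exact abs_le.2 ⟨by linarith, by linarith⟩
  rw [Real.dist_eq]
  have e : m (x * r) r / r ^ (n + 1) - l = (m (x * r) r - l * r ^ (n + 1)) / r ^ (n + 1) := by
    field_simp
  change |m (x * r) r / r ^ (n + 1) - l| < ε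
  rw [e, abs_div, abs_of_pos hrn, div_lt_iff₀ hrn]
  nlinarith

end IsCollapsing

end Mass

/-! ### The lapse and the radial null geodesics -/

/-- The metric coefficient `1 - 2 m / r ^ (N - 3)`, which vanishes at the apparent horizon. -/
def lapse (N : ℕ) (m : ℝ → ℝ → ℝ) (v r : ℝ) : ℝ := 1 - 2 * m v r / r ^ (N - 3)

/-- The partial derivative of the lapse in `v`, in terms of the mass function. -/
def lapseDot (N : ℕ) (m : ℝ → ℝ → ℝ) (v r : ℝ) : ℝ := -(2 * mDot m v r / r ^ (N - 3))

/-- The partial derivative of the lapse in `r`, in terms of the mass function. -/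
def lapsePrime (N : ℕ) (m : ℝ → ℝ → ℝ) (v r : ℝ) : ℝ :=
  2 / r * (((N : ℝ) - 3) * (m v r / r ^ (N - 3)) - mPrime m v r / r ^ (N - 4))

section Geodesic

variable {N : ℕ} {m : ℝ → ℝ → ℝ} {U : Set (ℝ × ℝ)} {c : ℝ}

theorem IsCollapsing.hasDerivAt_lapse (h : IsCollapsing N m U c) (hN : 4 ≤ N) {v r : ℝ → ℝ}
    {v' r' k : ℝ} (hz : (v k, r k) ∈ U) (hv : HasDerivAt v v' k) (hr : HasDerivAt r r' k) :
    HasDerivAt (fun t => lapse N m (v t) (r t))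
      (lapseDot N m (v k) (r k) * v' + lapsePrime N m (v k) (r k) * r') k := by
  obtain ⟨n, rfl⟩ : ∃ n, N = n + 4 := ⟨N - 4, by omega⟩
  have hr0 : r k ≠ 0 := (h.radius_pos _ hz).ne'
  have hd := (((h.hasDerivAt_mass hz hv hr).const_mul 2).div (hr.pow (n + 1))
    (pow_ne_zero _ hr0)).const_sub 1
  refine hd.congr_deriv ?_
  simp only [lapseDot, lapsePrime, Nat.add_sub_cancel_right, show n + 4 - 3 = n + 1 from rfl,
    show n + 4 - 4 = n from rfl, Pi.pow_apply]
  push_cast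
  field_simp
  ring

/-- A curve with `dv/dk = w` and `dr/dk = lapse * w / 2` is null, and it is an affinely
parametrised geodesic as soon as `w` solves the `r`-component of the Lagrange equations. -/
theorem isOutgoingRadialNullGeodesic_of_hasDerivAt (h : IsCollapsing N m U c) (hN : 4 ≤ N) {b : ℝ}
    {v r w : ℝ → ℝ} (hmem : ∀ k ∈ Ioo 0 b, (v k, r k) ∈ U)
    (hpos : ∀ k ∈ Ioo 0 b, 0 < lapse N m (v k) (r k)) (hw : ∀ k ∈ Ioo 0 b, 0 < w k)
    (hv' : ∀ k ∈ Ioo 0 b, HasDerivAt v (w k) k)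
    (hr' : ∀ k ∈ Ioo 0 b, HasDerivAt r (lapse N m (v k) (r k) * w k / 2) k)
    (hw' : ∀ k ∈ Ioo 0 b,
      HasDerivAt w (-(lapsePrime N m (v k) (r k) * w k ^ 2 / 2)) k) :
    IsOutgoingRadialNullGeodesic N m U b v r := by
  have g00 : ∀ x, metric N m x (Sum.inl 0) (Sum.inl 0) =
      -lapse N m (x (Sum.inl 0)) (x (Sum.inl 1)) := fun x => rfl
  have g01 : ∀ x, metric N m x (Sum.inl 0) (Sum.inl 1) = 1 := fun x => rfl
  have g10 : ∀ x, metric N m x (Sum.inl 1) (Sum.inl 0) = 1 := fun x => rfl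
  have g11 : ∀ x, metric N m x (Sum.inl 1) (Sum.inl 1) = 0 := fun x => rfl
  have gri : ∀ x j i, metric N m x (Sum.inr j) (Sum.inl i) = 0 := fun x j i => rfl
  have cr : ∀ (θ : Fin (N - 2) → ℝ) (i : Fin (N - 2)),
      (fun t => radialCurve v r θ t (Sum.inr i)) = fun _ => θ i := fun θ i => rfl
  have e0 : ∀ (θ : Fin (N - 2) → ℝ) k, radialCurve v r θ k (Sum.inl 0) = v k := fun _ _ => rfl
  have e1 : ∀ (θ : Fin (N - 2) → ℝ) k, radialCurve v r θ k (Sum.inl 1) = r k := fun _ _ => rfl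
  have hdv : ∀ k ∈ Ioo 0 b, deriv v =ᶠ[𝓝 k] w := fun k hk => by
    filter_upwards [Ioo_mem_nhds hk.1 hk.2] with t ht using (hv' t ht).deriv
  have hdr : ∀ k ∈ Ioo 0 b, deriv r =ᶠ[𝓝 k] fun t => lapse N m (v t) (r t) * w t / 2 :=
    fun k hk => by
      filter_upwards [Ioo_mem_nhds hk.1 hk.2] with t ht using (hr' t ht).deriv
  refine ⟨hmem, fun θ k hk a => ?_, fun θ k hk => ?_, fun k hk => ?_, fun k hk => ?_⟩
  · have hA := h.hasDerivAt_lapse hN (hmem k hk) (hv' k hk) (hr' k hk)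
    have hAv := h.hasDerivAt_lapse hN (v := fun y => y) (r := fun _ => r k) (hmem k hk)
      (hasDerivAt_id (v k)) (hasDerivAt_const (v k) (r k))
    have hAr := h.hasDerivAt_lapse hN (v := fun _ => v k) (r := fun y => y) (hmem k hk)
      (hasDerivAt_const (r k) (v k)) (hasDerivAt_id (r k))
    have hAr' : deriv (lapse N m (v k)) (r k) = _ := hAr.deriv
    rcases a with a | i
    · fin_cases a
      · simp only [Fin.zero_eta, Fintype.sum_sum_type, Fin.sum_univ_two, g00, g01, g10, g11, gri,
          cr, e0, e1, deriv_const', mul_zero, zero_mul, Finset.sum_const_zero, add_zero,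
          Function.update_self, Function.update_apply]
        refine ⟨(hv' k hk).differentiableAt,
          ((hw' k hk).congr_of_eventuallyEq (hdv k hk)).differentiableAt, ?_⟩
        have hd := ((hA.mul (hw' k hk)).div_const 2).neg
        refine (hd.congr_of_eventuallyEq ?_).congr_deriv ?_
        · filter_upwards [hdv k hk, hdr k hk] with t h1 h2
          rw [h1, h2]; simp; ring
        · simp [hAv.deriv, (hv' k hk).deriv]
          ring
      · simp only [Fin.mk_one, Fintype.sum_sum_type, Fin.sum_univ_two, g00, g01, g10, g11, gri,
          cr, e0, e1, deriv_const', mul_zero, zero_mul, Finset.sum_const_zero, add_zero,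
          Function.update_self, Function.update_apply]
        refine ⟨(hr' k hk).differentiableAt,
          (((hA.mul (hw' k hk)).div_const 2).congr_of_eventuallyEq (hdr k hk)).differentiableAt, ?_⟩
        refine ((hw' k hk).congr_of_eventuallyEq ?_).congr_deriv ?_
        · filter_upwards [hdv k hk] with t h1
          rw [h1]; simp
        · simp [hAr', (hv' k hk).deriv]
          ring
    · simp only [Fintype.sum_sum_type, Fin.sum_univ_two, g00, g01, g10, g11, gri,
          cr, e0, e1, deriv_const', mul_zero, zero_mul, Finset.sum_const_zero, add_zero,
          Function.update_apply]
      simp [hasDerivAt_const]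
  · simp only [Fintype.sum_sum_type, Fin.sum_univ_two, g00, g01, g10, g11, gri,
      cr, e0, e1, deriv_const', mul_zero, zero_mul, Finset.sum_const_zero, add_zero,
      (hv' k hk).deriv, (hr' k hk).deriv]
    ring
  · rw [(hv' k hk).deriv]; exact hw k hk
  · rw [(hr' k hk).deriv]
    exact div_pos (mul_pos (hpos k hk) (hw k hk)) two_pos

end Geodesic

/-! ### Outgoing null curves from the singularity -/

section Direction

variable {N : ℕ} {m : ℝ → ℝ → ℝ} {U : Set (ℝ × ℝ)} {c : ℝ} {p q : ℝ → ℝ}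

/-- The limit of the lapse at the singularity in the direction `X`. -/
def lapseLimit (N : ℕ) (p q : ℝ → ℝ) (X : ℝ) : ℝ :=
  1 - 2 * ((p X + X * q X) / ((N : ℝ) - 3))

theorem slopeLimit_eq (hN : 4 ≤ N) (X : ℝ) : slopeLimit N p q X = 2 / lapseLimit N p q X := by
  have hN' : (4:ℝ) ≤ N := by exact_mod_cast hN
  have h3 : (N : ℝ) - 3 ≠ 0 := by linarith
  have e : ((N : ℝ) - 3) - 2 * p X - 2 * q X * X = ((N : ℝ) - 3) * lapseLimit N p q X := by
    rw [lapseLimit]; field_simp; ring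
  rw [slopeLimit, e, mul_comm 2, mul_div_mul_left _ _ h3]

namespace IsCollapsing

variable (h : IsCollapsing N m U c)
include h

theorem tendsto_lapse (hN : 4 ≤ N) (hlim : HasDerivativeLimits N m c p q) {X : ℝ}
    (hX : X ∈ Ioo 0 c) :
    Tendsto (fun z : ℝ × ℝ => lapse N m (z.1 * z.2) z.2) (𝓝 X ×ˢ 𝓝[>] 0)
      (𝓝 (lapseLimit N p q X)) := by
  refine (((h.tendsto_mass_div hN hlim hX).const_mul 2).const_sub 1).congr fun z => ?_
  rw [lapse, mul_div_assoc]

/-- The radial derivative of the lapse behaves as `2 X q / r`, since the contributions of `m'` to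
`(N - 3) m / r` and to `m'` cancel. -/
theorem tendsto_mul_lapsePrime (hN : 4 ≤ N) (hlim : HasDerivativeLimits N m c p q) {X : ℝ}
    (hX : X ∈ Ioo 0 c) :
    Tendsto (fun z : ℝ × ℝ => z.2 * lapsePrime N m (z.1 * z.2) z.2) (𝓝 X ×ˢ 𝓝[>] 0)
      (𝓝 (2 * (X * q X))) := by
  have hN' : (4:ℝ) ≤ N := by exact_mod_cast hN
  have h3 : (N : ℝ) - 3 ≠ 0 := by linarith
  have h1 := (((h.tendsto_mass_div hN hlim hX).const_mul ((N : ℝ) - 3)).sub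
    ((hlim X hX).1.comp (tendsto_towards X))).const_mul 2
  rw [mul_div_cancel₀ _ h3, add_sub_cancel_left] at h1
  refine h1.congr' ?_
  filter_upwards [tendsto_snd.eventually self_mem_nhdsWithin] with z hz
  have hz' : z.2 ≠ 0 := (mem_Ioi.1 hz).ne'
  simp only [lapsePrime, Function.comp_apply]
  field_simp

theorem continuousOn_lapse : ContinuousOn (fun z : ℝ × ℝ => lapse N m z.1 z.2) U :=
  continuousOn_const.sub <| (continuousOn_const.mul h.contDiff.continuousOn).div
    (continuousOn_snd.pow _) fun z hz => pow_ne_zero _ (h.radius_pos z hz).ne'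

theorem continuousOn_lapsePrime : ContinuousOn (fun z : ℝ × ℝ => lapsePrime N m z.1 z.2) U :=
  (continuousOn_const.div continuousOn_snd fun z hz => (h.radius_pos z hz).ne').mul <|
    (continuousOn_const.mul <| h.contDiff.continuousOn.div (continuousOn_snd.pow _)
      fun z hz => pow_ne_zero _ (h.radius_pos z hz).ne').sub <|
    h.continuousOn_mPrime.div (continuousOn_snd.pow _)
      fun z hz => pow_ne_zero _ (h.radius_pos z hz).ne'

/-- The derivative in `v` of the slope `2 / lapse` of outgoing radial null curves. -/
theorem hasDerivAt_slope (hN : 4 ≤ N) {v r : ℝ} (hz : (v, r) ∈ U) (hl : lapse N m v r ≠ 0) :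
    HasDerivAt (fun y => 2 / lapse N m y r)
      (4 * (mDot m v r / r ^ (N - 4)) / lapse N m v r ^ 2 / r) v := by
  have h1 := h.hasDerivAt_lapse hN (v := fun y => y) (r := fun _ => r) hz (hasDerivAt_id v)
      (hasDerivAt_const v r)
  refine ((hasDerivAt_const v (2:ℝ)).div h1 hl).congr_deriv ?_
  have hr : r ≠ 0 := (h.radius_pos _ hz).ne'
  rw [lapseDot, show N - 3 = N - 4 + 1 by omega]
  field_simp
  ring

/-- Near a nondegenerate root `X₀` of the tangent equation, an outgoing radial null curve leaves
the singularity in the direction `X₀`, and along it the lapse and its radial derivative obey the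
bounds that make the affine parameter finite. -/
theorem exists_outgoing_curve (hN : 4 ≤ N) (hlim : HasDerivativeLimits N m c p q) {X₀ : ℝ}
    (hc : X₀ < c) (hroot : IsTangentRoot N p q X₀) (hsign : ChangesSignAt N p q X₀) :
    ∃ R > 0, ∃ κ > 0, ∃ V : ℝ → ℝ,
      (∀ r ∈ Ioo 0 R, (V r, r) ∈ U ∧ κ ≤ lapse N m (V r) r ∧
        -(1 / (2 * r)) ≤ lapsePrime N m (V r) r / lapse N m (V r) r ∧
        HasDerivAt V (2 / lapse N m (V r) r) r) ∧
      Tendsto (fun r => V r / r) (𝓝[>] 0) (𝓝 X₀) ∧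
      Tendsto (fun r => 2 / lapse N m (V r) r) (𝓝[>] 0) (𝓝 X₀) := by
  have hX₀ : X₀ ∈ Ioo 0 c := ⟨hroot.1, hc⟩
  have hroot' := hroot.2
  rw [slopeLimit_eq hN] at hroot'
  have hℓ : 0 < lapseLimit N p q X₀ := by
    have := hroot.1
    rw [hroot'] at this
    exact (div_pos_iff_of_pos_left two_pos).1 this
  set κ := lapseLimit N p q X₀ / 2 with hκ
  have hκ0 : 0 < κ := half_pos hℓ
  have hq := h.limit_mDot_nonneg hN hlim hX₀
  -- Bounds that hold in all directions close to `X₀`, at all small radii.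
  have hev : ∀ᶠ z : ℝ × ℝ in 𝓝 X₀ ×ˢ 𝓝[>] 0, z.1 ∈ Ioo 0 c ∧ (z.1 * z.2, z.2) ∈ U ∧
      κ < lapse N m (z.1 * z.2) z.2 ∧
      mDot m (z.1 * z.2) z.2 / z.2 ^ (N - 4) < q X₀ + 1 ∧
      -(1 / 2) < z.2 * lapsePrime N m (z.1 * z.2) z.2 / lapse N m (z.1 * z.2) z.2 := by
    have h1 := h.tendsto_lapse hN hlim hX₀
    have h2 := (h.tendsto_mul_lapsePrime hN hlim hX₀).div h1 hℓ.ne'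
    have h3 := (hlim X₀ hX₀).2.comp (tendsto_towards X₀)
    have hnn : 0 ≤ 2 * (X₀ * q X₀) / lapseLimit N p q X₀ := by have := hX₀.1; positivity
    exact (tendsto_fst.eventually (Ioo_mem_nhds hX₀.1 hX₀.2)).and <|
      (h.eventually_mem hX₀).and <| (h1.eventually (lt_mem_nhds (half_lt_self hℓ))).and <|
      (h3.eventually (gt_mem_nhds (lt_add_one _))).and
      (h2.eventually (lt_mem_nhds (by linarith)))
  obtain ⟨P, hP, Q, hQ, hPQ⟩ := eventually_prod_iff.1 hev
  have hσ : ∃ σ : ℝ, (σ = 1 ∨ σ = -1) ∧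
      ∀ᶠ X in 𝓝 X₀, X ≠ X₀ → 0 < σ * ((slopeLimit N p q X - X) * (X - X₀)) := by
    rcases hsign with hs | hs
    · exact ⟨1, Or.inl rfl, (eventually_nhdsWithin_iff.1 hs).mono fun X hX hne => by
        simpa using hX hne⟩
    · exact ⟨-1, Or.inr rfl, (eventually_nhdsWithin_iff.1 hs).mono fun X hX hne => by
        simpa using hX hne⟩
  obtain ⟨σ, hσ, hσX⟩ := hσ
  obtain ⟨δ, hδ, hδP⟩ := Metric.nhds_basis_closedBall.eventually_iff.1 (hP.and hσX)
  rw [Real.closedBall_eq_Icc] at hδP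
  set a := X₀ - δ with ha
  set b := X₀ + δ with hb
  have haI : a ∈ Icc a b := ⟨le_rfl, by linarith⟩
  have hbI : b ∈ Icc a b := ⟨by linarith, le_rfl⟩
  have hIc : ∀ x ∈ Icc a b, x ∈ Ioo 0 c := fun x hx => by
    obtain ⟨r, hr⟩ := hQ.exists
    exact (hPQ (hδP hx).1 hr).1
  have ha0 : 0 < a := (hIc a haI).1
  have hray : ∀ x : ℝ, Tendsto (fun r : ℝ => (x, r)) (𝓝[>] 0) (𝓝 x ×ˢ 𝓝[>] 0) := fun x =>
    tendsto_const_nhds.prodMk tendsto_id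
  have hf : ∀ X ∈ Icc a b, Tendsto (fun z : ℝ × ℝ => 2 / lapse N m (z.1 * z.2) z.2)
      (𝓝 X ×ˢ 𝓝[>] 0) (𝓝 (slopeLimit N p q X)) := fun X hX => by
    have h1 := h.tendsto_lapse hN hlim (hIc X hX)
    have h2 : κ ≤ lapseLimit N p q X := ge_of_tendsto (h1.comp (hray X)) <| by
      filter_upwards [hQ] with r hr
      exact (hPQ (hδP hX).1 hr).2.2.1.le
    rw [slopeLimit_eq hN]
    exact tendsto_const_nhds.div h1 (hκ0.trans_le h2).ne'
  -- The direction of the field on the two edges of the wedge, at small radii.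
  have hedge : ∀ x ∈ Icc a b, x ≠ X₀ →
      ∀ᶠ r in 𝓝[>] (0:ℝ), 0 < σ * ((2 / lapse N m (x * r) r - x) * (x - X₀)) := fun x hx hne =>
    (((((hf x hx).comp (hray x)).sub_const x).mul_const (x - X₀)).const_mul σ).eventually
      (lt_mem_nhds ((hδP hx).2 hne))
  have hev2 := hQ.and ((hedge a haI (by linarith)).and (hedge b hbI (by linarith)))
  obtain ⟨R, hR, hRQ⟩ := mem_nhdsGT_iff_exists_Ioc_subset.1 hev2
  rw [mem_Ioi] at hR
  set Φ : ℝ → ℝ → ℝ := fun v r => 2 / lapse N m v r with hΦ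
  have hw : ∀ z ∈ wedge a b R, z ∈ U ∧ κ < lapse N m z.1 z.2 ∧
      mDot m z.1 z.2 / z.2 ^ (N - 4) < q X₀ + 1 ∧
      -(1 / 2) < z.2 * lapsePrime N m z.1 z.2 / lapse N m z.1 z.2 := by
    rintro ⟨v, r⟩ ⟨hr, hv⟩
    have hr0 : 0 < r := hr.1
    have hx : v / r ∈ Icc a b := ⟨(le_div_iff₀ hr0).2 hv.1, (div_le_iff₀ hr0).2 hv.2⟩
    have := (hPQ (hδP hx).1 (hRQ hr).1).2
    rwa [div_mul_cancel₀ _ hr0.ne'] at this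
  have hΦc : ContinuousOn (fun z : ℝ × ℝ => Φ z.1 z.2) (wedge a b R) :=
    continuousOn_const.div (h.continuousOn_lapse.mono fun z hz => (hw z hz).1)
      fun z hz => (hκ0.trans (hw z hz).2.1).ne'
  have hΦb : ∀ z ∈ wedge a b R, |Φ z.1 z.2| ≤ 2 / κ := fun z hz => by
    have hl := (hw z hz).2.1
    rw [abs_of_pos (div_pos two_pos (hκ0.trans hl))]
    exact div_le_div_of_nonneg_left two_pos.le hκ0 hl.le
  have hΦd : ∀ r ∈ Ioc 0 R, ∀ v ∈ Icc (a * r) (b * r), HasDerivAt (fun v => Φ v r)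
      (4 * (mDot m v r / r ^ (N - 4)) / lapse N m v r ^ 2 / r) v := fun r hr v hv =>
    h.hasDerivAt_slope hN (hw (v, r) ⟨hr, hv⟩).1 (hκ0.trans (hw (v, r) ⟨hr, hv⟩).2.1).ne'
  have hab : a ≤ b := haI.2
  have hsol : ∃ V : ℝ → ℝ, (∀ r ∈ Ioo 0 R, V r ∈ Icc (a * r) (b * r)) ∧
      ∀ r ∈ Ioo 0 R, HasDerivAt V (Φ (V r) r) r := by
    rcases hσ with rfl | rfl
    · have hL0 : 0 ≤ 4 * (q X₀ + 1) / κ ^ 2 := by positivity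
      refine exists_solution_of_edges_outward (L := 4 * (q X₀ + 1) / κ ^ 2 + 2) ha0.le hab hR
        hΦc hΦb (by linarith) (fun r hr => ?_) (fun r hr => ?_) fun r hr => ?_
      · have hd : ∀ v ∈ Icc (a * r) (b * r), HasDerivAt
            (fun v => (4 * (q X₀ + 1) / κ ^ 2 + 2) * v / r - Φ v r)
            ((4 * (q X₀ + 1) / κ ^ 2 + 2) * 1 / r -
              4 * (mDot m v r / r ^ (N - 4)) / lapse N m v r ^ 2 / r) v := fun v hv =>
          (((hasDerivAt_id v).const_mul _).div_const r).sub (hΦd r hr v hv)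
        refine monotoneOn_of_deriv_nonneg (convex_Icc _ _)
          (fun v hv => (hd v hv).continuousAt.continuousWithinAt)
          (fun v hv => (hd v (interior_subset hv)).differentiableAt.differentiableWithinAt)
          fun v hv => ?_
        have hv' := interior_subset hv
        rw [(hd v hv').deriv, ← sub_div]
        refine div_nonneg ?_ hr.1.le
        have hz := hw (v, r) ⟨hr, hv'⟩
        have : 4 * (mDot m v r / r ^ (N - 4)) / lapse N m v r ^ 2 ≤ 4 * (q X₀ + 1) / κ ^ 2 :=
          div_le_div₀ (by positivity) (by linarith [hz.2.2.1]) (by positivity)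
            (pow_le_pow_left₀ hκ0.le hz.2.1.le 2)
        linarith
      · have := (hRQ hr).2.1
        rw [ha] at this ⊢
        simp only [hΦ]
        nlinarith
      · have := (hRQ hr).2.2
        rw [hb] at this ⊢
        simp only [hΦ]
        nlinarith
    · refine exists_solution_of_edges_inward hab hΦc hΦb (fun r hr => ?_) (fun r hr => ?_)
        fun r hr => ?_
      · refine monotoneOn_of_deriv_nonneg (convex_Icc _ _)
          (fun v hv => (hΦd r hr v hv).continuousAt.continuousWithinAt)
          (fun v hv => (hΦd r hr v (interior_subset hv)).differentiableAt.differentiableWithinAt)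
          fun v hv => ?_
        rw [(hΦd r hr v (interior_subset hv)).deriv]
        have hm := h.mDot_nonneg hN (hw (v, r) ⟨hr, interior_subset hv⟩).1
        have := hr.1
        positivity
      · have := (hRQ hr).2.1
        rw [ha] at this ⊢
        simp only [hΦ]
        nlinarith
      · have := (hRQ hr).2.2
        rw [hb] at this ⊢
        simp only [hΦ]
        nlinarith
  obtain ⟨V, hVw, hVd⟩ := hsol
  have hdir := tendsto_div_of_sign hR hσ hVw hVd hf fun X hX => (hδP hX).2
  refine ⟨R, hR, κ, hκ0, V, fun r hr => ?_, hdir, ?_⟩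
  · have hz := hw (V r, r) ⟨⟨hr.1, hr.2.le⟩, hVw r hr⟩
    refine ⟨hz.1, hz.2.1.le, ?_, hVd r hr⟩
    have h1 := hz.2.2.2
    have hr0 := hr.1
    have e1 : -(1 / (2 * r)) = -(1 / 2) / r := by field_simp
    rw [e1, div_le_iff₀ hr0]
    have e2 : lapsePrime N m (V r) r / lapse N m (V r) r * r =
      r * lapsePrime N m (V r) r / lapse N m (V r) r := by ring
    rw [e2]
    exact h1.le
  · have h1 := (hf X₀ ⟨by linarith, by linarith⟩).comp (hdir.prodMk tendsto_id)
    rw [← hroot.2] at h1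
    refine h1.congr' ?_
    filter_upwards [self_mem_nhdsWithin] with r hr
    simp [(mem_Ioi.1 hr).ne']

end IsCollapsing

/-- A function with continuous derivative `g` on `(0, ε)` and one-sided derivative `lim g` at `0`
is continuously differentiable up to `0`. -/
theorem contDiffOn_Ico_of_tendsto {ε d : ℝ} {V g : ℝ → ℝ}
    (hV : ∀ r ∈ Ioo 0 ε, HasDerivAt V (g r) r) (hV0 : HasDerivWithinAt V d (Ici 0) 0)
    (hg : ContinuousOn g (Ioo 0 ε)) (hg0 : Tendsto g (𝓝[>] 0) (𝓝 d)) :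
    ContDiffOn ℝ 1 V (Ico 0 ε) := by
  have hd : ∀ r ∈ Ico 0 ε, HasDerivWithinAt V (if r = 0 then d else g r) (Ico 0 ε) r := by
    intro r hr
    by_cases h : r = 0
    · subst h; simpa using hV0.mono Ico_subset_Ici_self
    · simpa [h] using (hV r ⟨lt_of_le_of_ne hr.1 (Ne.symm h), hr.2⟩).hasDerivWithinAt
  rw [contDiffOn_one_iff_derivWithin (uniqueDiffOn_Ico 0 ε)]
  refine ⟨fun r hr => (hd r hr).differentiableWithinAt, ?_⟩
  have hcont : ContinuousOn (fun r => if r = 0 then d else g r) (Ico 0 ε) := by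
    intro r hr
    by_cases h : r = 0
    · subst h
      have h1 : Tendsto (fun r => if r = 0 then d else g r) (𝓝[>] 0) (𝓝 d) :=
        hg0.congr' (by filter_upwards [self_mem_nhdsWithin] with s hs; simp [(mem_Ioi.1 hs).ne'])
      have h2 : ContinuousWithinAt (fun r => if r = 0 then d else g r) (Ioi 0) 0 := by
        simpa [ContinuousWithinAt] using h1
      exact (continuousWithinAt_Ioi_iff_Ici.1 h2).mono Ico_subset_Ici_self
    · have hr' : r ∈ Ioo 0 ε := ⟨lt_of_le_of_ne hr.1 (Ne.symm h), hr.2⟩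
      have h1 := hg.continuousAt (Ioo_mem_nhds hr'.1 hr'.2)
      refine (h1.congr ?_).continuousWithinAt
      filter_upwards [Ioo_mem_nhds hr'.1 hr'.2] with s hs
      simp [hs.1.ne']
  exact hcont.congr fun r hr => (hd r hr).derivWithin (uniqueDiffOn_Ico 0 ε r hr)

end Direction

end Vaidya

end

theorem proposition1 (N : ℕ) (hN : 4 ≤ N) (m : ℝ → ℝ → ℝ) (U : Set (ℝ × ℝ)) (c : ℝ)
    (hcollapse : Vaidya.IsCollapsing N m U c)
    (p q : ℝ → ℝ) (hlim : Vaidya.HasDerivativeLimits N m c p q)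
    (X₀ : ℝ) (hc : X₀ < c) (hroot : Vaidya.IsTangentRoot N p q X₀)
    (hsign : Vaidya.ChangesSignAt N p q X₀)
    (hhorizon : ∀ Y, Y < c → Vaidya.IsHorizonRoot N p q Y → X₀ < Y) :
    Vaidya.LocallyNaked N m U ∧
    ∃ ε > 0, ∃ V : ℝ → ℝ,
      ContDiffOn ℝ 1 V (Set.Ico 0 ε) ∧ V 0 = 0 ∧ HasDerivWithinAt V X₀ (Set.Ici 0) 0 ∧
      (∀ r ∈ Set.Ioo 0 ε, 2 * m (V r) r < r ^ (N - 3) ∧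
        HasDerivAt V (2 * r ^ (N - 3) / (r ^ (N - 3) - 2 * m (V r) r)) r) ∧
      ∃ b > 0, ∃ v r : ℝ → ℝ,
        Vaidya.IsOutgoingRadialNullGeodesic N m U b v r ∧ Vaidya.EmanatesFromSingularity v r ∧
        r '' Set.Ioo 0 b = Set.Ioo 0 ε ∧ ∀ k ∈ Set.Ioo 0 b, v k = V (r k) := by
  open Vaidya in
  obtain ⟨R, hR, κ, hκ, W, hW, hdir, hslope⟩ :=
    hcollapse.exists_outgoing_curve hN hlim hc hroot hsign
  set V : ℝ → ℝ := Function.update W 0 0 with hVdef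
  have hV0 : V 0 = 0 := Function.update_self ..
  have hVW : ∀ r, 0 < r → V r = W r := fun r hr => Function.update_of_ne hr.ne' ..
  have hVd : ∀ r ∈ Ioo 0 R, HasDerivAt V (2 / lapse N m (W r) r) r := fun r hr =>
    (hW r hr).2.2.2.congr_of_eventuallyEq <| by
      filter_upwards [Ioi_mem_nhds hr.1] with s hs using hVW s hs
  have hVder0 : HasDerivWithinAt V X₀ (Ici 0) 0 := by
    rw [hasDerivWithinAt_iff_tendsto_slope, Ici_sdiff_left]
    refine hdir.congr' ?_
    filter_upwards [self_mem_nhdsWithin] with r hr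
    rw [slope_def_field, hV0, hVW r hr, sub_zero, sub_zero]
  have hWc : ContinuousOn (fun r => (W r, r)) (Ioo 0 R) := fun r hr =>
    ((hW r hr).2.2.2.continuousAt.prodMk continuousAt_id).continuousWithinAt
  have hac : ContinuousOn (fun r => lapse N m (W r) r) (Ioo 0 R) :=
    hcollapse.continuousOn_lapse.comp hWc fun r hr => (hW r hr).1
  have hapos : ∀ r ∈ Ioo 0 R, 0 < lapse N m (W r) r := fun r hr => hκ.trans_le (hW r hr).2.1
  have hsub : Ioc 0 (R / 2) ⊆ Ioo 0 R := fun r hr => ⟨hr.1, by linarith [hr.2]⟩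
  have hsub' : Ioo 0 (R / 2) ⊆ Ioo 0 R := Ioo_subset_Ioc_self.trans hsub
  obtain ⟨u, hu, b, hb, ρ, himg, hρ, hρ0⟩ := exists_affine_parametrisation (half_pos hR) hκ
    (hac.mono hsub) (fun r hr => (hW r (hsub hr)).2.1)
    (α := fun r => lapsePrime N m (W r) r / lapse N m (W r) r)
    (((hcollapse.continuousOn_lapsePrime.comp hWc fun r hr => (hW r hr).1).div hac
      fun r hr => (hapos r hr).ne').mono hsub)
    (fun r hr => (hW r (hsub hr)).2.2.1)
  have hρI : ∀ k ∈ Ioo 0 b, ρ k ∈ Ioo 0 (R / 2) := fun k hk => himg ▸ mem_image_of_mem ρ hk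
  have hgeo : IsOutgoingRadialNullGeodesic N m U b (fun k => V (ρ k)) ρ := by
    refine isOutgoingRadialNullGeodesic_of_hasDerivAt (w := fun k => u (ρ k)) hcollapse hN
      (fun k hk => ?_) (fun k hk => ?_) (fun k hk => (hu _ (hρI k hk)).1) (fun k hk => ?_)
      (fun k hk => ?_) fun k hk => ?_
    all_goals
      have hk' := hsub' (hρI k hk)
      have ha := (hapos _ hk').ne'
      have hv := hVW _ hk'.1
    · simpa only [hv] using (hW _ hk').1
    · simpa only [hv] using hapos _ hk'
    · refine ((hVd _ hk').comp k (hρ k hk)).congr_deriv ?_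
      field_simp
    · simpa only [hv] using hρ k hk
    · refine ((hu _ (hρI k hk)).2.comp k (hρ k hk)).congr_deriv ?_
      simp only [hv]
      field_simp
  have hem : EmanatesFromSingularity (fun k => V (ρ k)) ρ := by
    have hV0' : Tendsto V (𝓝[Ici 0] 0) (𝓝 0) := by
      simpa [ContinuousWithinAt, hV0] using hVder0.continuousWithinAt
    have hρ0' : Tendsto ρ (𝓝[>] 0) (𝓝[Ici 0] 0) := tendsto_nhdsWithin_iff.2 ⟨hρ0, by
      filter_upwards [Ioo_mem_nhdsGT hb] with k hk using (hρI k hk).1.le⟩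
    exact (hV0'.comp hρ0').prodMk_nhds hρ0
  refine ⟨⟨b, hb, _, _, hgeo, hem⟩, R / 2, half_pos hR, V,
    contDiffOn_Ico_of_tendsto (fun r hr => hVd r (hsub' hr)) hVder0 ?_ hslope, hV0, hVder0,
    fun r hr => ?_, b, hb, _, ρ, hgeo, hem, himg, fun k _ => rfl⟩
  · exact continuousOn_const.div (hac.mono hsub') fun r hr => (hapos r (hsub' hr)).ne'
  · have hrn : 0 < r ^ (N - 3) := pow_pos hr.1 _
    have hl := hapos r (hsub' hr)
    have e : r ^ (N - 3) - 2 * m (W r) r = r ^ (N - 3) * lapse N m (W r) r := by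
      rw [lapse]; field_simp
    rw [hVW r hr.1]
    refine ⟨by nlinarith [mul_pos hrn hl], (hVd r (hsub' hr)).congr_deriv ?_⟩
    rw [e, mul_comm 2, mul_div_mul_left _ _ hrn.ne']
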